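/- **Setting.** A network has $K\ge 1$ nodes; node $k$ observes an $M_k$-dimensional random signal $\mathbf y_k$, and $\mathbf y=[\mathbf y_1^T,\dots,\mathbf y_K^T]^T\in\mathbb R^M$, $M=\sum_k M_k$. Filters are matrices $X=[X_1^T,\dots,X_K^T]^T\in\mathbb R^{M\times Q}$ with blocks $X_k\in\mathbb R^{M_k\times Q}$. Consider the problem $\min_X L(X)$ with $L$ of one of the following two forms, where $\delta_{\mathcal X}$ is the indicator function ($0$ on $\mathcal X$, $+\infty$ elsewhere) of the set $\mathcal X$ described by finitely many constraints $\vartheta_j(X)\le 0$ ($j\in J_I$), $\vartheta_j(X)=0$ ($j\in J_E$), and where $\varphi$ and the $\eta_j$ are real-valued, may involve statistics of their random argument, and are such that $X\mapsto\varphi(X^T\mathbf y,X^TB)$ and the $\vartheta_j$ are continuously differentiable. * Smooth case: $L(X)=\varphi(X^T\mathbf y,X^TB)+\delta_{\mathcal X}(X)$, with $\vartheta_j(X)=\eta_j(X^T\mathbf y,X^TD_j)$. * Non-smooth case: $L(X)=\varphi(X^T\mathbf y,X^TB)+\sum_k\gamma_k(X_k^TA_k)+\delta_{\mathcal X}(X)$,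 with arbitrary functions $\gamma_k$ with values in $(-\infty,+\infty]$, where each constraint belongs to a node $k=k(j)$ and $\vartheta_j(X)=\eta_j(X_k^T\mathbf y_k,X_k^TD_j)$. Here $B,D_j,A_k$ are given deterministic matrices. For an extended-real-valued $f$ and a point $x$ with $f(x)$ finite, $\hat\partial f(x)$ is the set of $v$ with $f(x')\ge f(x)+\langle v,x'-x\rangle+o(\|x'-x\|)$ as $x'\to x$, and $\partial f(x)$ is the set of limits $v=\lim v^j$ with $v^j\in\hat\partial f(x^j)$, $x^j\to x$, $f(x^j)\to f(x)$; both are empty if $f(x)$ is not finite. A stationary point of $f$ is a point $x$ with $f(x)$ finite and $0\in\partial f(x)$. Norms and inner products of matrices are those of Frobenius. **Algorithm.** For a node $q$, let $C_q(X)$ be the matrix for which $C_q(X)\widetilde X$, with $\widetilde X=[\widetilde X_q^T,\widetilde X_1^T,\dots,\widetilde X_{q-1}^T,\widetilde X_{q+1}^T,\dots,\widetilde X_K^T]^T$, $\widetilde X_q\in\mathbb R^{M_q\times Q}$ and $\widetilde X_k\in\mathbb R^{Q\times Q}$ for $k\ne q$, has the blocks $\widetilde X_q$ at $q$ and $X_k\widetilde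 X_k$ at every $k\neq q$. A sequence $(X^i)_{i\in\mathbb N}$ is generated by the DASF algorithm with an inexact local solver if, with the updating node $q=q^i$ of iteration $i$ running cyclically through the nodes and $\widetilde L^i(\widetilde X)=L(C_q(X^i)\widetilde X)$, there are local iterates $(\widetilde X^{i,j})_{j\in\mathbb N}$ and constants $R^i,c^i>0$ with * (C1) $\widetilde X^{i,0}=[X_q^{iT},I_Q,\dots,I_Q]^T$; * (C2) $\widetilde L^i(\widetilde X^{i,j})-\widetilde L^i(\widetilde X^{i,j+1})\ge R^i\|\widetilde X^{i,j}-\widetilde X^{i,j+1}\|^2$ for all $i,j$; * (C3) for all $i,j$ there is $W\in\partial\widetilde L^i(\widetilde X^{i,j+1})$ with $\|W\|\le c^i\|\widetilde X^{i,j}-\widetilde X^{i,j+1}\|$; * (C4) $\liminf_i R^i>0$ and $\limsup_i c^i<\infty$; and $X^{i+1}=C_q(X^i)\widetilde X^{i,n_i}$ for all $i$, where the numbers $n_i\ge 1$ of local solver steps are arbitrary but bounded: $\sup_i n_i<\infty$. **Theorem.** Let $(X^i)$ be generated by the DASF algorithm with an inexact local solver. Assume that $L$ is continuous on its domain $\{L<\infty\}$,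 that the sublevel sets $\{L\le\alpha\}$, $\alpha\in\mathbb R$, are compact, and that at every accumulation point $\bar X$ of $(X^i)$ the compressed LICQ holds: the matrices $\mathrm{blkdiag}(\bar X_1,\dots,\bar X_K)^T\nabla\vartheta_j(\bar X)$, for $j\in J_E$ and for $j\in J_I$ with $\vartheta_j(\bar X)=0$, are linearly independent. Then the set $\Omega$ of stationary points of $L$ is non-empty and $(X^i)$ converges to it: $$\lim_{i\to\infty}\ \inf_{X\in\Omega}\|X-X^i\|=0.$$ If moreover $\Omega$ is finite, then $(X^i)$ converges to a single point, which belongs to $\Omega$. -/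

import Mathlib

open Filter Topology

noncomputable section

namespace DASF

/-! ### Subgradients of extended-real-valued functions -/

section Subgradients

variable {E : Type*} [NormedAddCommGroup E] [InnerProductSpace ℝ E]

/-- Regular subgradients of `f` at `x` (empty unless `f x` is finite):
`f x' ≥ f x + ⟪v, x' - x⟫ + o(‖x' - x‖)` as `x' → x`, that is, the lower limit of
`(f x' - f x - ⟪v, x' - x⟫) / ‖x' - x‖` as `x' → x`, `x' ≠ x`, is nonnegative. -/
def regularSubdifferential (f : E → EReal) (x : E) : Set E :=
  {v | f x ≠ ⊤ ∧ f x ≠ ⊥ ∧ ∀ ε : ℝ, 0 < ε → ∀ᶠ x' in 𝓝 x,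
    f x + ((inner ℝ v (x' - x) - ε * ‖x' - x‖ : ℝ) : EReal) ≤ f x'}

/-- General (limiting) subgradients of `f` at `x` (empty unless `f x` is finite). -/
def subdifferential (f : E → EReal) (x : E) : Set E :=
  {v | f x ≠ ⊤ ∧ f x ≠ ⊥ ∧ ∃ (xs : ℕ → E) (vs : ℕ → E),
    Tendsto xs atTop (𝓝 x) ∧ Tendsto (fun j => f (xs j)) atTop (𝓝 (f x)) ∧
    (∀ j, vs j ∈ regularSubdifferential f (xs j)) ∧ Tendsto vs atTop (𝓝 v)}

/-- The stationary points of `f`: `f x` is finite and `0 ∈ ∂f(x)`. -/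
def stationaryPoints (f : E → EReal) : Set E :=
  {x | 0 ∈ subdifferential f x}

end Subgradients

/-! ### Matrices with the Frobenius inner product -/

/-- Real `m × n` matrices with the Frobenius inner product and norm. -/
abbrev FMat (m n : Type*) [Fintype m] [Fintype n] := EuclideanSpace ℝ (m × n)

/-- The underlying matrix. -/
def FMat.mat {m n : Type*} [Fintype m] [Fintype n] (X : FMat m n) : Matrix m n ℝ :=
  Matrix.of fun i j => X (i, j)

/-- A matrix, seen as an element of the Euclidean space of matrices. -/
def FMat.ofMat {m n : Type*} [Fintype m] [Fintype n] (A : Matrix m n ℝ) : FMat m n :=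
  WithLp.toLp 2 fun p => A p.1 p.2

/-! ### Network-wide filters, local filters and the map between them

`K` nodes; node `k` has `M k` channels; filters have `Q` output channels. -/

/-- The `∑ k, M k` channels of the network-wide signal: pairs of a node and one of its channels. -/
abbrev Rows {K : ℕ} (M : Fin K → ℕ) := Σ k : Fin K, Fin (M k)

/-- Network-wide filters `X = [X₁ᵀ, …, X_Kᵀ]ᵀ`. -/
abbrev GlobalVar {K : ℕ} (M : Fin K → ℕ) (Q : ℕ) := FMat (Rows M) (Fin Q)

/-- The rows of the local variable at node `q`: first the `M q` rows of the block of `q`, then a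
block of `Q` rows for each other node. -/
abbrev LocalRows {K : ℕ} (M : Fin K → ℕ) (Q : ℕ) (q : Fin K) :=
  Fin (M q) ⊕ ({k : Fin K // k ≠ q} × Fin Q)

/-- Local variables at node `q`. -/
abbrev LocalVar {K : ℕ} (M : Fin K → ℕ) (Q : ℕ) (q : Fin K) := FMat (LocalRows M Q q) (Fin Q)

variable {K : ℕ} {M : Fin K → ℕ} {Q : ℕ}

/-- The block `X_k` of a network-wide filter. -/
def block (X : GlobalVar M Q) (k : Fin K) : Matrix (Fin (M k)) (Fin Q) ℝ :=
  Matrix.of fun m c => X (⟨k, m⟩, c)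

/-- The matrix `C_q(X)`. Its columns belonging to `q` embed the block of `q`; its columns belonging
to another node `l` hold the block `X_l` in the rows of `l`, and zeros elsewhere. -/
def compressionMatrix (q : Fin K) (X : GlobalVar M Q) :
    Matrix (Rows M) (LocalRows M Q q) ℝ :=
  Matrix.of fun p r =>
    match r with
    | Sum.inl m => if p = ⟨q, m⟩ then 1 else 0
    | Sum.inr (l, c) => if p.1 = l.1 then X (p, c) else 0

/-- The linear map `X̃ ↦ C_q(X) X̃` from the local variables to the network-wide filters: block `q`
of the result is block `q` of `X̃`, and block `k ≠ q` of the result is `X_k X̃_k`. -/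
def localToGlobal (q : Fin K) (X : GlobalVar M Q) (Xt : LocalVar M Q q) : GlobalVar M Q :=
  FMat.ofMat (compressionMatrix q X * Xt.mat)

/-- The starting point `[X_qᵀ, I_Q, …, I_Q]ᵀ` of the local solver at node `q`. -/
def localStart (q : Fin K) (X : GlobalVar M Q) : LocalVar M Q q :=
  FMat.ofMat (Matrix.of fun r c =>
    match r with
    | Sum.inl m => X (⟨q, m⟩, c)
    | Sum.inr (_, c') => if c' = c then 1 else 0)

/-- The local objective `X̃ ↦ L(C_q(X) X̃)` at node `q` when the current filter is `X`. -/
def localObjective (L : GlobalVar M Q → EReal) (q : Fin K) (X : GlobalVar M Q) :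
    LocalVar M Q q → EReal :=
  fun Xt => L (localToGlobal q X Xt)

/-! ### The optimization problems

A random variable is a function on the sample space `S`. The functionals `φ` and `η j` act on random
variables, so that they contain whatever statistics (expectations, …) turn them into numbers. -/

/-- The filter output `Xᵀ y`, as a random variable. -/
def filterOutput {S m : Type*} [Fintype m] (X : Matrix m (Fin Q) ℝ) (y : S → m → ℝ) :
    S → Fin Q → ℝ :=
  fun ω => Matrix.mulVec X.transpose (y ω)

/-- The smooth problem: minimize `φ(Xᵀy, XᵀB)` subject to `η_j(Xᵀy, XᵀD_j) = 0` for the equality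
constraints and `η_j(Xᵀy, XᵀD_j) ≤ 0` for the others. -/
structure SmoothProblem {K : ℕ} (M : Fin K → ℕ) (Q : ℕ) (S : Type*) where
  /-- the network-wide signal -/
  y : S → Rows M → ℝ
  /-- number of columns of `B` -/
  b : ℕ
  B : Matrix (Rows M) (Fin b) ℝ
  φ : (S → Fin Q → ℝ) → Matrix (Fin Q) (Fin b) ℝ → ℝ
  /-- number of constraints -/
  J : ℕ
  /-- which constraints are equality constraints -/
  isEq : Fin J → Prop
  /-- numbers of columns of the `D j` -/
  d : Fin J → ℕ
  D : (j : Fin J) → Matrix (Rows M) (Fin (d j)) ℝ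
  η : (j : Fin J) → (S → Fin Q → ℝ) → Matrix (Fin Q) (Fin (d j)) ℝ → ℝ
  smooth_φ : ContDiff ℝ 1 fun X : GlobalVar M Q => φ (filterOutput X.mat y) (X.mat.transpose * B)
  smooth_η : ∀ j, ContDiff ℝ 1 fun X : GlobalVar M Q =>
    η j (filterOutput X.mat y) (X.mat.transpose * D j)

/-- The non-smooth problem: minimize `φ(Xᵀy, XᵀB) + ∑ k, γ_k(X_kᵀA_k)` subject to constraints each
of which belongs to a node `k` and has the form `η_j(X_kᵀy_k, X_kᵀD_j) = 0`, or `≤ 0`.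
The `γ_k` need neither be smooth nor convex, and may take the value `+∞`. -/
structure NonsmoothProblem {K : ℕ} (M : Fin K → ℕ) (Q : ℕ) (S : Type*) where
  /-- the network-wide signal -/
  y : S → Rows M → ℝ
  /-- number of columns of `B` -/
  b : ℕ
  B : Matrix (Rows M) (Fin b) ℝ
  φ : (S → Fin Q → ℝ) → Matrix (Fin Q) (Fin b) ℝ → ℝ
  /-- numbers of columns of the `A k` -/
  a : Fin K → ℕ
  A : (k : Fin K) → Matrix (Fin (M k)) (Fin (a k)) ℝ
  γ : (k : Fin K) → Matrix (Fin Q) (Fin (a k)) ℝ → EReal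
  γ_ne_bot : ∀ k Z, γ k Z ≠ ⊥
  /-- number of constraints -/
  J : ℕ
  /-- the node to which a constraint belongs -/
  node : Fin J → Fin K
  /-- which constraints are equality constraints -/
  isEq : Fin J → Prop
  /-- numbers of columns of the `D j` -/
  d : Fin J → ℕ
  D : (j : Fin J) → Matrix (Fin (M (node j))) (Fin (d j)) ℝ
  η : (j : Fin J) → (S → Fin Q → ℝ) → Matrix (Fin Q) (Fin (d j)) ℝ → ℝ
  smooth_φ : ContDiff ℝ 1 fun X : GlobalVar M Q => φ (filterOutput X.mat y) (X.mat.transpose * B)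
  smooth_η : ∀ j, ContDiff ℝ 1 fun X : GlobalVar M Q =>
    η j (filterOutput (block X (node j)) fun ω m => y ω ⟨node j, m⟩)
      ((block X (node j)).transpose * D j)

/-- A problem of one of the two classes. -/
inductive Problem {K : ℕ} (M : Fin K → ℕ) (Q : ℕ) (S : Type*) where
  | smooth (P : SmoothProblem M Q S)
  | nonsmooth (P : NonsmoothProblem M Q S)

variable {S : Type*}

/-- The number of constraints. -/
def Problem.numConstraints : Problem M Q S → ℕ
  | .smooth P => P.J
  | .nonsmooth P => P.J

/-- Which constraints are equality constraints. -/
def Problem.isEq : (P : Problem M Q S) → Fin P.numConstraints → Prop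
  | .smooth P => P.isEq
  | .nonsmooth P => P.isEq

/-- The constraint functions `ϑ_j` of the network-wide filter. -/
def Problem.constraint : (P : Problem M Q S) → Fin P.numConstraints → GlobalVar M Q → ℝ
  | .smooth P => fun j X => P.η j (filterOutput X.mat P.y) (X.mat.transpose * P.D j)
  | .nonsmooth P => fun j X =>
      P.η j (filterOutput (block X (P.node j)) fun ω m => P.y ω ⟨P.node j, m⟩)
        ((block X (P.node j)).transpose * P.D j)

/-- The feasible set. -/
def Problem.feasibleSet (P : Problem M Q S) : Set (GlobalVar M Q) :=
  {X | ∀ j, (P.isEq j → P.constraint j X = 0) ∧ (¬ P.isEq j → P.constraint j X ≤ 0)}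

/-- The cost without the constraints. -/
def Problem.cost : Problem M Q S → GlobalVar M Q → EReal
  | .smooth P => fun X => (P.φ (filterOutput X.mat P.y) (X.mat.transpose * P.B) : EReal)
  | .nonsmooth P => fun X => (P.φ (filterOutput X.mat P.y) (X.mat.transpose * P.B) : EReal) +
      ∑ k, P.γ k ((block X k).transpose * P.A k)

open Classical in
/-- The objective `L`: the cost plus the indicator function (`0` or `+∞`) of the feasible set. -/
def Problem.objective (P : Problem M Q S) (X : GlobalVar M Q) : EReal :=
  P.cost X + if X ∈ P.feasibleSet then 0 else ⊤

/-- The compressed linear independence constraint qualification at `X`: the compressed gradients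
`blkdiag(X₁, …, X_K)ᵀ ∇ϑ_j(X)` of the equality constraints and of the active inequality constraints
are linearly independent. -/
def Problem.CompressedLICQ (P : Problem M Q S) (X : GlobalVar M Q) : Prop :=
  LinearIndependent ℝ fun j : {j : Fin P.numConstraints // P.isEq j ∨ P.constraint j X = 0} =>
    (Matrix.blockDiagonal' fun k => block X k).transpose *
      FMat.mat (gradient (P.constraint j.1) X)

/-! ### The algorithm -/

/-- The updating node of iteration `i`: the nodes take turns cyclically. -/
def updatingNode (K : ℕ) [NeZero K] (i : ℕ) : Fin K := Fin.ofNat K i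

/-- `Xt i j` are iterates of an inexact iterative local solver for the objective `L`, where `X i`
is the network-wide filter at iteration `i`. -/
def IsInexactSolver [NeZero K] (L : GlobalVar M Q → EReal) (X : ℕ → GlobalVar M Q)
    (Xt : (i : ℕ) → ℕ → LocalVar M Q (updatingNode K i)) : Prop :=
  ∃ R c : ℕ → ℝ,
    -- (C1) initialization
    (∀ i, Xt i 0 = localStart (updatingNode K i) (X i)) ∧
    -- (C2) sufficient decrease
    (∀ i, 0 < R i ∧ ∀ j,
      localObjective L (updatingNode K i) (X i) (Xt i (j + 1)) +
          ((R i * ‖Xt i j - Xt i (j + 1)‖ ^ 2 : ℝ) : EReal) ≤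
        localObjective L (updatingNode K i) (X i) (Xt i j)) ∧
    -- (C3) small steps imply near-stationarity
    (∀ i, 0 < c i ∧ ∀ j,
      ∃ W ∈ subdifferential (localObjective L (updatingNode K i) (X i)) (Xt i (j + 1)),
        ‖W‖ ≤ c i * ‖Xt i j - Xt i (j + 1)‖) ∧
    -- (C4) the constants do not degenerate
    0 < liminf (fun i => (R i : EReal)) atTop ∧
    limsup (fun i => (c i : EReal)) atTop < ⊤

/-- `X` is a sequence of filters generated by the algorithm with an inexact local solver: at
iteration `i` the updating node runs `n i > 0` solver steps from the current filter, with `n`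
bounded, and the result is mapped back to the network-wide filter. -/
def IsInexactDASFSequence [NeZero K] (L : GlobalVar M Q → EReal) (X : ℕ → GlobalVar M Q) : Prop :=
  ∃ (n : ℕ → ℕ) (Xt : (i : ℕ) → ℕ → LocalVar M Q (updatingNode K i)),
    (∀ i, 0 < n i) ∧ (∃ N, ∀ i, n i ≤ N) ∧
    IsInexactSolver L X Xt ∧
    ∀ i, X (i + 1) = localToGlobal (updatingNode K i) (X i) (Xt i (n i))

end DASF

end

/-!
The objective decreases along the algorithm and is bounded below, so the sufficient decrease and
the boundedness of the numbers of solver steps make the local steps, hence also the steps of `X`,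
tend to zero; the last local iterates then carry vanishing subgradients of the local objectives
(`IsInexactDASFSequence.asymptotics`). Since the nodes take turns and the steps of `X` vanish, the
neighborhood of a cluster point `X₀` is visited at the turn of every node. So for every `q` there
are filters `U l → X₀` and local points converging to the representation of `X₀` at which the
local objectives built from `U l` have vanishing regular subgradients
(`IsLocallyAlmostStationary`). It remains to conclude that `0 ∈ ∂L(X₀)`; the rest is compactness,
and for a finite set of stationary points the fact that a sequence with vanishing steps cannot
jump between its points.

*Smooth problem.* The inverse function theorem shows that regular subgradients of the local
objective are given by Lagrange multipliers as long as the gradients of the constraints in the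
local variables are linearly independent. This holds near `X₀` by the compressed LICQ, because
every node can realize all the filters `blkdiag(X₁, …, X_K) N`. The multipliers have an explicit
form which passes to the limit (`exists_multiplier_of_tendsto`). The limits may a priori depend on
the node, but tested with the filters `blkdiag(X₁, …, X_K) N` they satisfy one and the same
equation, whose solution is unique by the compressed LICQ. With common multipliers, the free
blocks of the different nodes add up to the full KKT conditions at `X₀`
(`SmoothProblem.mem_stationaryPoints`), and these imply `0 ∈ ∂L(X₀)`.

*Non-smooth problem.* Here `L` is a smooth function plus a sum of functions of the single blocks.
A subgradient of the local objective at node `q`, restricted to the free block of `q`, yields a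
subgradient of the summand of `q`. Gluing the blocks of nearby points of the different nodes gives
points converging to `X₀` with regular subgradients of `L` that tend to `0`
(`mem_stationaryPoints_of_separable`).
-/

namespace DASF

/-! ### The linear maps between local, network-wide and compressed variables -/

section LocalVariables

variable {K : ℕ} {M : Fin K → ℕ} {Q : ℕ}

theorem localToGlobal_apply_self (q : Fin K) (X : GlobalVar M Q) (Z : LocalVar M Q q)
    (m : Fin (M q)) (c : Fin Q) :
    localToGlobal q X Z (⟨q, m⟩, c) = Z (Sum.inl m, c) := by
  have h : ∀ x : {k : Fin K // k ≠ q} × Fin Q,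
      (if q = x.1.1 then X (⟨q, m⟩, x.2) else 0) * Z (Sum.inr x, c) = 0 := fun x => by
    rw [if_neg x.1.2.symm, zero_mul]
  simp only [localToGlobal, compressionMatrix, FMat.ofMat, FMat.mat, Matrix.mul_apply,
    Matrix.of_apply, Fintype.sum_sum_type]
  rw [Finset.sum_eq_zero fun x _ => h x, add_zero, Finset.sum_eq_single m]
  · simp
  · intro b _ hb
    simp [hb.symm]
  · simp

theorem localToGlobal_apply_of_ne (q : Fin K) (X : GlobalVar M Q) (Z : LocalVar M Q q)
    {k : Fin K} (hk : k ≠ q) (m : Fin (M k)) (c : Fin Q) :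
    localToGlobal q X Z (⟨k, m⟩, c) =
      ∑ c', X (⟨k, m⟩, c') * Z (Sum.inr (⟨k, hk⟩, c'), c) := by
  have h : ∀ m' : Fin (M q),
      (if (⟨k, m⟩ : Rows M) = ⟨q, m'⟩ then (1 : ℝ) else 0) * Z (Sum.inl m', c) = 0 :=
    fun m' => by
      rw [if_neg fun h => hk (congrArg Sigma.fst h), zero_mul]
  simp only [localToGlobal, compressionMatrix, FMat.ofMat, FMat.mat, Matrix.mul_apply,
    Matrix.of_apply, Fintype.sum_sum_type]
  rw [Finset.sum_eq_zero fun x _ => h x, zero_add, Fintype.sum_prod_type,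
    Finset.sum_eq_single ⟨k, hk⟩]
  · simp
  · intro b _ hb
    have : k ≠ b.1 := fun h => hb (Subtype.ext h.symm)
    simp [this]
  · simp

/-- Two network-wide filters are equal if their entries agree at the rows of node `q`, and at the
rows of the other nodes. -/
theorem globalVar_ext (q : Fin K) {X Y : GlobalVar M Q}
    (hq : ∀ m c, X (⟨q, m⟩, c) = Y (⟨q, m⟩, c))
    (h : ∀ k, k ≠ q → ∀ m c, X (⟨k, m⟩, c) = Y (⟨k, m⟩, c)) : X = Y := by
  ext ⟨⟨k, m⟩, c⟩
  by_cases hk : k = q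
  · subst hk; exact hq m c
  · exact h k hk m c

/-- `localToGlobal q X` as a continuous linear map. -/
noncomputable def localToGlobalL (q : Fin K) (X : GlobalVar M Q) :
    LocalVar M Q q →L[ℝ] GlobalVar M Q :=
  LinearMap.toContinuousLinearMap
    { toFun := localToGlobal q X
      map_add' := fun Z Z' => by
        refine globalVar_ext q (fun m c => ?_) fun k hk m c => ?_
        · simp [localToGlobal_apply_self]
        · simp [localToGlobal_apply_of_ne _ _ _ hk, mul_add, Finset.sum_add_distrib]
      map_smul' := fun a Z => by
        refine globalVar_ext q (fun m c => ?_) fun k hk m c => ?_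
        · simp [localToGlobal_apply_self]
        · simp [localToGlobal_apply_of_ne _ _ _ hk, Finset.mul_sum, mul_left_comm] }

@[simp] theorem localToGlobalL_apply (q : Fin K) (X : GlobalVar M Q) (Z : LocalVar M Q q) :
    localToGlobalL q X Z = localToGlobal q X Z := rfl

theorem continuous_localToGlobalL (q : Fin K) :
    Continuous fun X : GlobalVar M Q => localToGlobalL q X := by
  rw [continuous_clm_apply]
  intro Z
  refine (PiLp.continuous_toLp 2 _).comp (continuous_pi (f := fun X p => localToGlobal q X Z p) ?_)
  rintro ⟨⟨k, m⟩, c⟩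
  by_cases hk : k = q
  · subst hk
    simp only [localToGlobal_apply_self]
    exact continuous_const
  · simp only [localToGlobal_apply_of_ne _ _ _ hk]
    fun_prop

@[simp] theorem localStart_inl (q : Fin K) (X : GlobalVar M Q) (m : Fin (M q)) (c : Fin Q) :
    localStart q X (Sum.inl m, c) = X (⟨q, m⟩, c) := rfl

@[simp] theorem localStart_inr (q : Fin K) (X : GlobalVar M Q) (l : {k : Fin K // k ≠ q})
    (c' c : Fin Q) : localStart q X (Sum.inr (l, c'), c) = if c' = c then 1 else 0 := rfl

theorem continuous_localStart (q : Fin K) :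
    Continuous fun X : GlobalVar M Q => localStart q X := by
  refine (PiLp.continuous_toLp 2 _).comp (continuous_pi (f := fun X p => localStart q X p) ?_)
  rintro ⟨m | ⟨l, c'⟩, c⟩
  · simp only [localStart_inl]
    fun_prop
  · simp only [localStart_inr]
    exact continuous_const

/-- The starting point of the local solver represents the current filter. -/
theorem localToGlobal_localStart (q : Fin K) (X : GlobalVar M Q) :
    localToGlobal q X (localStart q X) = X := by
  refine globalVar_ext q (fun m c => ?_) fun k hk m c => ?_
  · simp [localToGlobal_apply_self]
  · simp [localToGlobal_apply_of_ne _ _ _ hk]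

/-- The orthogonal projection of network-wide filters that keeps the block of node `q` and sets the
other blocks to zero. -/
noncomputable def blockProj (q : Fin K) : GlobalVar M Q →L[ℝ] GlobalVar M Q :=
  LinearMap.toContinuousLinearMap
    { toFun := fun X => WithLp.toLp 2 fun p => if p.1.1 = q then X p else 0
      map_add' := fun X Y => by ext p; by_cases h : p.1.1 = q <;> simp [h]
      map_smul' := fun a X => by ext p; by_cases h : p.1.1 = q <;> simp [h] }

@[simp] theorem blockProj_apply (q : Fin K) (X : GlobalVar M Q) (p : Rows M × Fin Q) :
    blockProj q X p = if p.1.1 = q then X p else 0 := rfl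

theorem sum_blockProj (X : GlobalVar M Q) : ∑ q, blockProj q X = X := by
  ext p
  simp [WithLp.ofLp_sum, Finset.sum_apply]

theorem inner_blockProj (q : Fin K) (X Y : GlobalVar M Q) :
    inner ℝ (blockProj q X) Y = inner ℝ X (blockProj q Y) := by
  simp only [PiLp.inner_apply, blockProj_apply]
  refine Finset.sum_congr rfl fun p _ => ?_
  split_ifs <;> simp

theorem block_eq_of_blockProj_eq {k : Fin K} {X Y : GlobalVar M Q}
    (h : blockProj k X = blockProj k Y) : block X k = block Y k := by
  ext m c
  have := congrArg (fun Z : GlobalVar M Q => Z (⟨k, m⟩, c)) h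
  simpa [block] using this

theorem blockProj_blockProj_self (q : Fin K) (X : GlobalVar M Q) :
    blockProj q (blockProj q X) = blockProj q X := by
  ext p
  by_cases h : p.1.1 = q <;> simp [h]

theorem blockProj_blockProj_of_ne {q k : Fin K} (h : k ≠ q) (X : GlobalVar M Q) :
    blockProj k (blockProj q X) = 0 := by
  ext p
  by_cases hk : p.1.1 = k <;> simp [hk, h]

/-- The local variable at node `q` whose block of `q` is that of the given network-wide filter and
whose other blocks are zero. -/
noncomputable def blockToLocal (q : Fin K) : GlobalVar M Q →L[ℝ] LocalVar M Q q :=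
  LinearMap.toContinuousLinearMap
    { toFun := fun X => WithLp.toLp 2 fun p => Sum.elim (fun m => X (⟨q, m⟩, p.2)) 0 p.1
      map_add' := fun X Y => by ext ⟨m | l, c⟩ <;> simp
      map_smul' := fun a X => by ext ⟨m | l, c⟩ <;> simp }

theorem localToGlobal_blockToLocal (q : Fin K) (U X : GlobalVar M Q) :
    localToGlobal q U (blockToLocal q X) = blockProj q X := by
  refine globalVar_ext q (fun m c => ?_) fun k hk m c => ?_
  · rw [localToGlobal_apply_self]
    simp [blockToLocal]
  · rw [localToGlobal_apply_of_ne _ _ _ hk]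
    simp [blockToLocal, hk]

/-- The compressed variables: one `Q × Q` matrix for every node. -/
abbrev CompressedVar (K Q : ℕ) := FMat (Σ _ : Fin K, Fin Q) (Fin Q)

/-- The map `N ↦ blkdiag(X₁, …, X_K) N`. -/
noncomputable def compressedToGlobal (X : GlobalVar M Q) :
    CompressedVar K Q →L[ℝ] GlobalVar M Q :=
  LinearMap.toContinuousLinearMap
    { toFun := fun N => FMat.ofMat (Matrix.blockDiagonal' (fun k => block X k) * N.mat)
      map_add' := fun N N' => by
        ext p
        simp [FMat.ofMat, FMat.mat, Matrix.mul_apply, mul_add, Finset.sum_add_distrib]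
      map_smul' := fun a N => by
        ext p
        simp [FMat.ofMat, FMat.mat, Matrix.mul_apply, Finset.mul_sum, mul_left_comm] }

theorem compressedToGlobal_eq (X : GlobalVar M Q) (N : CompressedVar K Q) :
    compressedToGlobal X N =
      FMat.ofMat (Matrix.blockDiagonal' (fun k => block X k) * N.mat) := rfl

theorem compressedToGlobal_apply (X : GlobalVar M Q) (N : CompressedVar K Q) (k : Fin K)
    (m : Fin (M k)) (c : Fin Q) :
    compressedToGlobal X N (⟨k, m⟩, c) = ∑ c', X (⟨k, m⟩, c') * N (⟨k, c'⟩, c) := by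
  rw [compressedToGlobal_eq]
  simp only [FMat.ofMat, FMat.mat, Matrix.mul_apply, Matrix.of_apply, Fintype.sum_sigma]
  rw [Finset.sum_eq_single k]
  · simp [block]
  · intro b _ hb
    refine Finset.sum_eq_zero fun c' _ => ?_
    rw [Matrix.blockDiagonal'_apply_ne _ _ _ hb.symm, zero_mul]
  · simp

/-- Every node can realize the compressed variables: the filter `blkdiag(X₁, …, X_K) N` is of the
form `C_q(X) X̃`. -/
theorem exists_localToGlobal_eq_compressedToGlobal (q : Fin K) (X : GlobalVar M Q)
    (N : CompressedVar K Q) : ∃ Z, localToGlobal q X Z = compressedToGlobal X N := by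
  refine ⟨WithLp.toLp 2 fun p => Sum.elim (fun m => compressedToGlobal X N (⟨q, m⟩, p.2))
    (fun l => N (⟨l.1.1, l.2⟩, p.2)) p.1, globalVar_ext q (fun m c => ?_) fun k hk m c => ?_⟩
  · rw [localToGlobal_apply_self]
    simp
  · rw [localToGlobal_apply_of_ne _ _ _ hk, compressedToGlobal_apply]
    simp

theorem inner_compressedToGlobal_single (X V : GlobalVar M Q) (r : Σ _ : Fin K, Fin Q)
    (c : Fin Q) :
    inner ℝ V (compressedToGlobal X (EuclideanSpace.single (r, c) 1)) =
      ((Matrix.blockDiagonal' fun k => block X k).transpose * FMat.mat V) r c := by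
  rw [compressedToGlobal_eq]
  simp only [PiLp.inner_apply, FMat.ofMat, FMat.mat, Matrix.mul_apply, Matrix.of_apply,
    Fintype.sum_prod_type]
  refine Finset.sum_congr rfl fun p _ => ?_
  simp [Prod.ext_iff, ite_and]

end LocalVariables

/-! ### Lagrange multipliers for regular subgradients, and their limits -/

section Limits

variable {E F E' ι : Type*} [NormedAddCommGroup E] [NormedSpace ℝ E] [NormedAddCommGroup F]
  [NormedSpace ℝ F] [NormedAddCommGroup E'] [NormedSpace ℝ E'] {l : Filter ι}

theorem _root_.Filter.Tendsto.clm_apply {T : ι → E →L[ℝ] F} {T₀ : E →L[ℝ] F} {x : ι → E} {x₀ : E}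
    (hT : Tendsto T l (𝓝 T₀)) (hx : Tendsto x l (𝓝 x₀)) :
    Tendsto (fun i => T i (x i)) l (𝓝 (T₀ x₀)) :=
  (isBoundedBilinearMap_apply.continuous.tendsto (T₀, x₀)).comp (hT.prodMk_nhds hx)

theorem _root_.Filter.Tendsto.clm_comp {T : ι → E →L[ℝ] F} {T₀ : E →L[ℝ] F} {R : ι → E' →L[ℝ] E}
    {R₀ : E' →L[ℝ] E} (hT : Tendsto T l (𝓝 T₀)) (hR : Tendsto R l (𝓝 R₀)) :
    Tendsto (fun i => (T i).comp (R i)) l (𝓝 (T₀.comp R₀)) :=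
  (isBoundedBilinearMap_comp.continuous.tendsto (T₀, R₀)).comp (hT.prodMk_nhds hR)

end Limits

section Multipliers

variable {E H F : Type*} [NormedAddCommGroup E] [InnerProductSpace ℝ E]
  [NormedAddCommGroup H] [InnerProductSpace ℝ H] [NormedAddCommGroup F] [NormedSpace ℝ F]

theorem regularSubdifferential_subset (f : E → EReal) (x : E) :
    regularSubdifferential f x ⊆ subdifferential f x := fun v hv =>
  ⟨hv.1, hv.2.1, fun _ => x, fun _ => v, tendsto_const_nhds, tendsto_const_nhds, fun _ => hv,
    tendsto_const_nhds⟩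

/-- If the derivative of `G` at `z` has a right inverse, then every direction `d` is the velocity of
an arc along which `G` is affine. The arc is the image of the line `z + t d` under the local inverse
of `x ↦ x + R (G x - G z - G' (x - z))`, whose derivative at `z` is the identity. -/
theorem exists_arc [CompleteSpace E] {G : E → F} {G' : E →L[ℝ] F} {z : E}
    (hG : HasStrictFDerivAt G G' z) (R : F →L[ℝ] E) (hR : ∀ y, G' (R y) = y) (d : E) :
    ∃ x : ℝ → E, x 0 = z ∧ HasDerivAt x d 0 ∧ ∀ᶠ t in 𝓝 (0 : ℝ), G (x t) = G z + t • G' d := by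
  have hΦ : HasStrictFDerivAt (fun x => x + R (G x - G z - G' (x - z)))
      ((ContinuousLinearEquiv.refl ℝ E : E ≃L[ℝ] E) : E →L[ℝ] E) z := by
    have h1 : HasStrictFDerivAt (fun x => G x - G z - G' (x - z)) (G' - G') z :=
      (hG.sub_const _).sub ((G'.hasStrictFDerivAt).comp z ((hasStrictFDerivAt_id z).sub_const z))
    have h2 := (hasStrictFDerivAt_id z).add (R.hasStrictFDerivAt.comp z h1)
    rw [sub_self, ContinuousLinearMap.comp_zero, add_zero] at h2
    exact h2
  have hz : (fun x => x + R (G x - G z - G' (x - z))) z = z := by simp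
  set ψ := hΦ.localInverse _ _ _ with hψ
  have hψz : ψ z = z := by
    have h : ψ ((fun x => x + R (G x - G z - G' (x - z))) z) = z := hΦ.localInverse_apply_image
    rwa [hz] at h
  have hψ' : HasFDerivAt ψ (ContinuousLinearMap.id ℝ E) z := by
    have h : HasFDerivAt ψ _ ((fun x => x + R (G x - G z - G' (x - z))) z) :=
      hΦ.to_localInverse.hasFDerivAt
    rw [hz] at h
    exact h
  have hright : ∀ᶠ y in 𝓝 z, ψ y + R (G (ψ y) - G z - G' (ψ y - z)) = y := by
    have h : ∀ᶠ y in 𝓝 ((fun x => x + R (G x - G z - G' (x - z))) z),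
        ψ y + R (G (ψ y) - G z - G' (ψ y - z)) = y := hΦ.eventually_right_inverse
    rwa [hz] at h
  have hline : HasDerivAt (fun t : ℝ => z + t • d) d 0 := by
    simpa using ((hasDerivAt_id (0 : ℝ)).smul_const d).const_add z
  have hline0 : z + (0 : ℝ) • d = z := by simp
  refine ⟨fun t => ψ (z + t • d), by simp [hψz], ?_, ?_⟩
  · have h := HasFDerivAt.comp_hasDerivAt (f := fun t : ℝ => z + t • d) (0 : ℝ)
      (by rw [hline0]; exact hψ') hline
    exact h
  · have ht : Tendsto (fun t : ℝ => z + t • d) (𝓝 0) (𝓝 z) := by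
      have := hline.continuousAt.tendsto
      rwa [hline0] at this
    filter_upwards [ht.eventually hright] with t h
    have h' := congrArg G' h
    simp only [map_add, hR, map_smul, map_sub] at h'
    rw [← sub_eq_zero] at h' ⊢
    rw [← h']
    abel

/-- A regular subgradient bounds the derivative of a majorant along an arc from below. -/
theorem inner_le_of_mem_regularSubdifferential {h : E → EReal} {f : E → ℝ} {f' : E →L[ℝ] ℝ}
    {z v d : E} (hv : v ∈ regularSubdifferential h z) (hf : HasFDerivAt f f' z) (hz : h z = f z)
    {x : ℝ → E} (hx0 : x 0 = z) (hx : HasDerivAt x d 0)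
    (hle : ∀ᶠ t in 𝓝[>] (0 : ℝ), h (x t) ≤ f (x t)) : inner ℝ v d ≤ f' d := by
  have hslope : Tendsto (fun t : ℝ => t⁻¹ • (x t - z)) (𝓝[>] 0) (𝓝 d) := by
    simpa [hx0] using hx.tendsto_slope_zero_right
  have hfx : HasDerivAt (fun t => f (x t)) (f' d) 0 :=
    HasFDerivAt.comp_hasDerivAt (0 : ℝ) (by rw [hx0]; exact hf) hx
  have hfslope : Tendsto (fun t : ℝ => t⁻¹ * (f (x t) - f z)) (𝓝[>] 0) (𝓝 (f' d)) := by
    simpa [hx0] using hfx.tendsto_slope_zero_right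
  have hxz : Tendsto x (𝓝[>] 0) (𝓝 z) := by
    have := hx.continuousAt.tendsto
    rw [hx0] at this
    exact this.mono_left nhdsWithin_le_nhds
  have key : ∀ ε : ℝ, 0 < ε → inner ℝ v d - ε * ‖d‖ ≤ f' d := by
    intro ε hε
    refine le_of_tendsto_of_tendsto
      (((tendsto_const_nhds (x := v)).inner hslope).sub (hslope.norm.const_mul ε)) hfslope ?_
    filter_upwards [hxz.eventually (hv.2.2 ε hε), hle, self_mem_nhdsWithin] with t h1 h2 ht
    have ht' : (0 : ℝ) < t⁻¹ := inv_pos.2 ht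
    rw [hz] at h1
    have h3 : f z + (inner ℝ v (x t - z) - ε * ‖x t - z‖) ≤ f (x t) := by
      exact_mod_cast h1.trans h2
    rw [norm_smul, Real.norm_of_nonneg ht'.le, inner_smul_right]
    nlinarith
  refine le_of_forall_pos_le_add fun δ hδ => ?_
  have h := key (δ / (‖d‖ + 1)) (by positivity)
  have : δ / (‖d‖ + 1) * ‖d‖ ≤ δ := by
    rw [div_mul_eq_mul_div, div_le_iff₀ (by positivity)]
    nlinarith [norm_nonneg d]
  linarith

/-- The cone of the values of constraint functions that satisfy the constraints: the coordinates in
`e` belong to equality constraints, the others to inequality constraints. -/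
def admissibleCone {A : Type*} (e : A → Prop) : Set (A → ℝ) :=
  {y | ∀ j, (e j → y j = 0) ∧ (¬ e j → y j ≤ 0)}

theorem add_smul_mem_admissibleCone {A : Type*} {e : A → Prop} {y y' : A → ℝ} (hy : y ∈ admissibleCone e)
    (hy' : y' ∈ admissibleCone e) {t : ℝ} (ht : 0 ≤ t) : y + t • y' ∈ admissibleCone e := by
  refine fun j => ⟨fun hj => ?_, fun hj => ?_⟩
  · simp [(hy j).1 hj, (hy' j).1 hj]
  · simpa using add_nonpos ((hy j).2 hj) (mul_nonpos_of_nonneg_of_nonpos ht ((hy' j).2 hj))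

variable {A : Type*} [Fintype A] {e : A → Prop}

/-- Under a constraint qualification (`R` is a right inverse of the derivative of the constraints),
a regular subgradient of a smooth function restricted to the feasible set is bounded by the
derivative in all directions that are feasible to first order. -/
theorem inner_le_of_constraints [CompleteSpace E] {h : E → EReal} {f : E → ℝ} {f' : E →L[ℝ] ℝ}
    {G : E → A → ℝ} {G' : E →L[ℝ] A → ℝ} {z v d : E}
    (hv : v ∈ regularSubdifferential h z) (hf : HasFDerivAt f f' z)
    (hG : HasStrictFDerivAt G G' z) (R : (A → ℝ) →L[ℝ] E) (hR : ∀ y, G' (R y) = y)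
    (hGz : G z ∈ admissibleCone e)
    (hfeas : ∀ᶠ x in 𝓝 z, G x ∈ admissibleCone e → h x = f x)
    (hd : G' d ∈ admissibleCone e) : inner ℝ v d ≤ f' d := by
  obtain ⟨x, hx0, hx, hGx⟩ := exists_arc hG R hR d
  refine inner_le_of_mem_regularSubdifferential hv hf (hfeas.self_of_nhds hGz) hx0 hx ?_
  have hxz : Tendsto x (𝓝 0) (𝓝 z) := by
    have := hx.continuousAt.tendsto
    rwa [hx0] at this
  filter_upwards [nhdsWithin_le_nhds (hxz.eventually hfeas), nhdsWithin_le_nhds hGx,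
    self_mem_nhdsWithin] with t h1 h2 ht
  refine (h1 ?_).le
  rw [h2]
  exact add_smul_mem_admissibleCone hGz hd (le_of_lt ht)

/-- Multipliers survive a limit. Vanishing regular subgradients of `L ∘ T l`, where `T l → T₀`, yield
multipliers at the limit point on the range of `T₀`. The multipliers of the approximations are
`(W l - f') ∘ R l` for right inverses `R l` of the derivatives of the constraints that converge to a
right inverse `R` at the limit; in the limit they are `-f' ∘ R`. -/
theorem exists_multiplier_of_tendsto [CompleteSpace E]
    {L : H → EReal} {f : H → ℝ} {G : H → A → ℝ}
    (hf : ContDiff ℝ 1 f) (hG : ContDiff ℝ 1 G) {T : ℕ → E →L[ℝ] H} {T₀ : E →L[ℝ] H}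
    {z W : ℕ → E} {z₀ : E} (hT : Tendsto T atTop (𝓝 T₀)) (hz : Tendsto z atTop (𝓝 z₀))
    (hW : Tendsto W atTop (𝓝 0))
    (hsub : ∀ l, W l ∈ regularSubdifferential (fun x => L (T l x)) (z l))
    (hdom : ∀ x, L x ≠ ⊤ → G x ∈ admissibleCone e)
    (hfeas : ∀ᶠ x in 𝓝 (T₀ z₀), G x ∈ admissibleCone e → L x = f x)
    (hsurj : Function.Surjective fun d => fderiv ℝ G (T₀ z₀) (T₀ d)) :
    ∃ m : (A → ℝ) →L[ℝ] ℝ,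
      (∀ d, fderiv ℝ f (T₀ z₀) (T₀ d) + m (fderiv ℝ G (T₀ z₀) (T₀ d)) = 0) ∧
      ∀ y ∈ admissibleCone e, m y ≤ 0 := by
  classical
  obtain ⟨R, hR⟩ := ((fderiv ℝ G (T₀ z₀)).comp T₀).exists_rightInverse_of_surjective
    (LinearMap.range_eq_top.2 hsurj)
  have hR' : ∀ y, fderiv ℝ G (T₀ z₀) (T₀ (R y)) = y := fun y => by
    simpa using congrArg (fun B : (A → ℝ) →L[ℝ] A → ℝ => B y) hR
  have hTz : Tendsto (fun l => T l (z l)) atTop (𝓝 (T₀ z₀)) := hT.clm_apply hz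
  have hf' : Tendsto (fun l => fderiv ℝ f (T l (z l))) atTop (𝓝 (fderiv ℝ f (T₀ z₀))) :=
    ((hf.continuous_fderiv one_ne_zero).tendsto _).comp hTz
  have hG' : Tendsto (fun l => fderiv ℝ G (T l (z l))) atTop (𝓝 (fderiv ℝ G (T₀ z₀))) :=
    ((hG.continuous_fderiv one_ne_zero).tendsto _).comp hTz
  set B : ℕ → (A → ℝ) →L[ℝ] A → ℝ := fun l =>
    (fderiv ℝ G (T l (z l))).comp ((T l).comp R) with hB
  have hBlim : Tendsto B atTop (𝓝 1) := by
    have h1 := hG'.clm_comp (hT.clm_comp (tendsto_const_nhds (x := R)))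
    rwa [show (fderiv ℝ G (T₀ z₀)).comp (T₀.comp R) = 1 from hR] at h1
  have hBinv : Tendsto (fun l => Ring.inverse (B l)) atTop (𝓝 1) := by
    have h := (NormedRing.inverse_continuousAt (1 : ((A → ℝ) →L[ℝ] A → ℝ)ˣ)).tendsto
    rw [Units.val_one, Ring.inverse_one] at h
    exact h.comp hBlim
  have hBunit : ∀ᶠ l in atTop, IsUnit (B l) :=
    hBlim.eventually (Units.isOpen.mem_nhds isUnit_one)
  have hRl : Tendsto (fun l => R.comp (Ring.inverse (B l))) atTop (𝓝 R) := by
    have h := (tendsto_const_nhds (x := R)).clm_comp hBinv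
    rwa [show R.comp 1 = R from R.comp_id] at h
  have hbound : ∀ᶠ l in atTop,
      (∀ y, fderiv ℝ G (T l (z l)) (T l (R (Ring.inverse (B l) y))) = y) ∧
      ∀ d, fderiv ℝ G (T l (z l)) (T l d) ∈ admissibleCone e →
        inner ℝ (W l) d ≤ fderiv ℝ f (T l (z l)) (T l d) := by
    filter_upwards [hBunit, hTz.eventually hfeas.eventually_nhds] with l hu hl
    have hRr : ∀ y, fderiv ℝ G (T l (z l)) (T l (R (Ring.inverse (B l) y))) = y := fun y => by
      simpa [hB] using congrArg (fun B : (A → ℝ) →L[ℝ] A → ℝ => B y) (Ring.mul_inverse_cancel _ hu)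
    refine ⟨hRr, fun d hd => ?_⟩
    exact inner_le_of_constraints (e := e) (h := fun x => L (T l x)) (f := fun x => f (T l x))
      (G := fun x => G (T l x)) (f' := (fderiv ℝ f (T l (z l))).comp (T l))
      (G' := (fderiv ℝ G (T l (z l))).comp (T l)) (hsub l)
      (((hf.differentiable one_ne_zero) _).hasFDerivAt.comp _ (T l).hasFDerivAt)
      ((hG.contDiffAt.hasStrictFDerivAt one_ne_zero).comp _ (T l).hasStrictFDerivAt)
      (R.comp (Ring.inverse (B l))) hRr (hdom _ (hsub l).1)
      (((T l).continuous.tendsto _).eventually hl) hd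
  -- passing to the limit in the bound, for convergent sequences of directions
  have hlim : ∀ {d : ℕ → E} {d₀ : E}, Tendsto d atTop (𝓝 d₀) →
      (∀ᶠ l in atTop, fderiv ℝ G (T l (z l)) (T l (d l)) ∈ admissibleCone e) →
      0 ≤ fderiv ℝ f (T₀ z₀) (T₀ d₀) := by
    intro d d₀ hd hadm
    have h1 := hW.inner (𝕜 := ℝ) hd
    rw [inner_zero_left] at h1
    refine le_of_tendsto_of_tendsto h1 (hf'.clm_apply (hT.clm_apply hd)) ?_
    filter_upwards [hbound, hadm] with l h2 h3 using h2.2 _ h3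
  have h0 : (0 : A → ℝ) ∈ admissibleCone e := fun j => by simp
  have hker : ∀ d, 0 ≤ fderiv ℝ f (T₀ z₀) (T₀ (d - R (fderiv ℝ G (T₀ z₀) (T₀ d)))) := by
    intro d
    refine hlim (d := fun l => d - R (Ring.inverse (B l) (fderiv ℝ G (T l (z l)) (T l d))))
      (tendsto_const_nhds.sub
        (hRl.clm_apply (hG'.clm_apply (hT.clm_apply tendsto_const_nhds)))) ?_
    filter_upwards [hbound] with l hl
    rw [map_sub, map_sub, hl.1, sub_self]
    exact h0
  refine ⟨-((fderiv ℝ f (T₀ z₀)).comp (T₀.comp R)), fun d => ?_, fun y hy => ?_⟩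
  · have h1 := hker d
    have h2 := hker (-d)
    simp only [map_sub, map_neg, neg_apply,
      ContinuousLinearMap.comp_apply] at h1 h2 ⊢
    linarith
  · have h1 : 0 ≤ fderiv ℝ f (T₀ z₀) (T₀ (R y)) := by
      refine hlim (d := fun l => R (Ring.inverse (B l) y)) (hRl.clm_apply tendsto_const_nhds) ?_
      filter_upwards [hbound] with l hl
      rw [hl.1]
      exact hy
    simpa using h1

/-- A point with multipliers, at which all the constraints in question are active, is stationary. -/
theorem zero_mem_regularSubdifferential_of_multiplier {L : H → EReal} {f : H → ℝ}
    {G : H → A → ℝ} {f' : H →L[ℝ] ℝ} {G' : H →L[ℝ] A → ℝ} {x₀ : H}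
    (hf : HasFDerivAt f f' x₀) (hG : HasFDerivAt G G' x₀) (hx₀ : L x₀ = f x₀) (hact : G x₀ = 0)
    (hdom : ∀ x, L x ≠ ⊤ → G x ∈ admissibleCone e ∧ L x = f x)
    {m : (A → ℝ) →L[ℝ] ℝ} (hm : ∀ u, f' u + m (G' u) = 0)
    (hmle : ∀ y ∈ admissibleCone e, m y ≤ 0) : 0 ∈ regularSubdifferential L x₀ := by
  refine ⟨by simp [hx₀], by simp [hx₀], fun ε hε => ?_⟩
  have hd : HasFDerivAt (fun x => f x + m (G x)) (0 : H →L[ℝ] ℝ) x₀ := by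
    have h := hf.add (m.hasFDerivAt.comp x₀ hG)
    rwa [show f' + m.comp G' = 0 from ContinuousLinearMap.ext hm] at h
  filter_upwards [hd.isLittleO.bound hε] with x hx
  by_cases hLx : L x = ⊤
  · simp [hLx]
  obtain ⟨h1, h2⟩ := hdom x hLx
  rw [h2, hx₀]
  have h3 := hmle _ h1
  have h4 := (abs_le.1 (by simpa [hact] using hx)).1
  have : f x₀ + (inner ℝ 0 (x - x₀) - ε * ‖x - x₀‖) ≤ f x := by
    rw [inner_zero_left]
    linarith
  exact_mod_cast this

end Multipliers

/-! ### Local almost-stationarity -/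

section StationarityFromLocal

variable {K : ℕ} {M : Fin K → ℕ} {Q : ℕ} {S : Type*}

/-- Node `q` sees `X₀` as almost stationary: for filters `U l → X₀` there are local points converging
to the representation of `X₀` at which the local objectives have vanishing regular subgradients. -/
def IsLocallyAlmostStationary (L : GlobalVar M Q → EReal) (q : Fin K) (X₀ : GlobalVar M Q) : Prop :=
  ∃ (U : ℕ → GlobalVar M Q) (z W : ℕ → LocalVar M Q q),
    Tendsto U atTop (𝓝 X₀) ∧ Tendsto z atTop (𝓝 (localStart q X₀)) ∧ Tendsto W atTop (𝓝 0) ∧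
    ∀ l, W l ∈ regularSubdifferential (localObjective L q (U l)) (z l)

/-- If the compressed vectors `blkdiag(X₁, …, X_K)ᵀ g_j` are linearly independent, then the functionals
`⟪g_j, ·⟫` take arbitrary values on the filters `blkdiag(X₁, …, X_K) N`. -/
theorem surjective_inner_compressedToGlobal {A : Type*} [Fintype A] (X : GlobalVar M Q)
    (g : A → GlobalVar M Q)
    (h : LinearIndependent ℝ fun j =>
      (Matrix.blockDiagonal' fun k => block X k).transpose * FMat.mat (g j)) :
    Function.Surjective fun (N : CompressedVar K Q) j =>
      (inner ℝ (g j) (compressedToGlobal X N) : ℝ) := by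
  classical
  let s : CompressedVar K Q →ₗ[ℝ] A → ℝ :=
    LinearMap.pi fun j => ((innerSL ℝ (g j)).comp (compressedToGlobal X)).toLinearMap
  change Function.Surjective s
  rw [← LinearMap.range_eq_top]
  by_contra hs
  obtain ⟨m, hm0, hm⟩ := Submodule.exists_le_ker_of_lt_top _ (lt_top_iff_ne_top.2 hs)
  refine hm0 (LinearMap.pi_ext' fun j => LinearMap.ext_ring ?_)
  have hsum : ∑ j, m (Pi.single j 1) •
      ((Matrix.blockDiagonal' fun k => block X k).transpose * FMat.mat (g j)) = 0 := by
    ext r c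
    have h1 : m (s (EuclideanSpace.single (r, c) 1)) = 0 := hm ⟨_, rfl⟩
    rw [LinearMap.pi_apply_eq_sum_univ m] at h1
    simp only [Matrix.sum_apply, Matrix.smul_apply, Matrix.zero_apply,
      ← inner_compressedToGlobal_single]
    rw [← h1]
    refine Finset.sum_congr rfl fun j _ => ?_
    rw [smul_eq_mul, smul_eq_mul, mul_comm]
    congr 2
    ext i
    simp [Pi.single_apply, eq_comm]
  simpa using Fintype.linearIndependent_iff.1 h _ hsum j

/-! ### The smooth problem -/

/-- The smooth part of the cost. -/
noncomputable def SmoothProblem.smoothCost (P : SmoothProblem M Q S) (X : GlobalVar M Q) : ℝ :=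
  P.φ (filterOutput X.mat P.y) (X.mat.transpose * P.B)

theorem SmoothProblem.objective_of_mem (P : SmoothProblem M Q S) {X : GlobalVar M Q}
    (h : X ∈ (Problem.smooth P).feasibleSet) :
    (Problem.smooth P).objective X = P.smoothCost X := by
  rw [Problem.objective, if_pos h, add_zero]
  rfl

theorem SmoothProblem.mem_feasibleSet (P : SmoothProblem M Q S) {X : GlobalVar M Q}
    (h : (Problem.smooth P).objective X ≠ ⊤) : X ∈ (Problem.smooth P).feasibleSet := by
  by_contra hX
  refine h ?_
  rw [Problem.objective, if_neg hX]
  exact EReal.coe_add_top _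

/-- For the smooth problem, local almost-stationarity at all nodes implies stationarity. Each node
yields multipliers; by the compressed LICQ these are determined by their action on the filters
`blkdiag(X₁, …, X_K) N`, which all the nodes can realize, so that they do not depend on the node.
Testing the common multipliers with the free block of each node gives the KKT conditions. -/
theorem SmoothProblem.mem_stationaryPoints [NeZero K] (P : SmoothProblem M Q S)
    {X₀ : GlobalVar M Q} (hfin : (Problem.smooth P).objective X₀ ≠ ⊤)
    (hlicq : (Problem.smooth P).CompressedLICQ X₀)
    (hloc : ∀ q, IsLocallyAlmostStationary (Problem.smooth P).objective q X₀) :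
    X₀ ∈ stationaryPoints (Problem.smooth P).objective := by
  classical
  set L := (Problem.smooth P).objective with hL
  set ϑ : Fin P.J → GlobalVar M Q → ℝ := (Problem.smooth P).constraint with hϑ
  let A := {j : Fin P.J // P.isEq j ∨ ϑ j X₀ = 0}
  let e : A → Prop := fun j => P.isEq j.1
  let G : GlobalVar M Q → A → ℝ := fun X j => ϑ j.1 X
  have hX₀ : X₀ ∈ (Problem.smooth P).feasibleSet := P.mem_feasibleSet hfin
  have hf : ContDiff ℝ 1 P.smoothCost := P.smooth_φ
  have hG : ContDiff ℝ 1 G := contDiff_pi.2 fun j => P.smooth_η j.1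
  have hadm : ∀ X, L X ≠ ⊤ → G X ∈ admissibleCone e := fun X hX j => P.mem_feasibleSet hX j.1
  have hval : ∀ X, L X ≠ ⊤ → L X = P.smoothCost X := fun X hX =>
    P.objective_of_mem (P.mem_feasibleSet hX)
  have hact : G X₀ = 0 := by
    ext j
    exact j.2.elim (fun h => (hX₀ j.1).1 h) fun h => h
  have hfeas : ∀ᶠ X in 𝓝 X₀, G X ∈ admissibleCone e → L X = P.smoothCost X := by
    have hinact : ∀ᶠ X in 𝓝 X₀, ∀ j, ϑ j X₀ < 0 → ϑ j X < 0 := by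
      refine eventually_all.2 fun j => ?_
      by_cases hj : ϑ j X₀ < 0
      · filter_upwards [((P.smooth_η j).continuous.tendsto X₀).eventually_lt_const hj] with X hX _
        exact hX
      · exact Eventually.of_forall fun X h => absurd h hj
    filter_upwards [hinact] with X hX hGX
    refine P.objective_of_mem fun j => ?_
    by_cases hj : P.isEq j ∨ ϑ j X₀ = 0
    · exact hGX ⟨j, hj⟩
    · obtain ⟨h1, h2⟩ := not_or.1 hj
      exact ⟨fun h => absurd h h1, fun h => (hX j (lt_of_le_of_ne ((hX₀ j).2 h) h2)).le⟩
  have hfderiv : ∀ u j, fderiv ℝ G X₀ u j = inner ℝ (gradient (ϑ j.1) X₀) u := by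
    intro u j
    rw [inner_gradient_left, fderiv_apply ((hG.differentiable one_ne_zero) X₀)]
    rfl
  have hsurj : Function.Surjective fun N => fderiv ℝ G X₀ (compressedToGlobal X₀ N) := by
    have h := surjective_inner_compressedToGlobal X₀ (fun j : A => gradient (ϑ j.1) X₀) hlicq
    intro y
    obtain ⟨N, hN⟩ := h y
    exact ⟨N, by rw [← hN]; ext j; exact hfderiv _ j⟩
  have hmult : ∀ q, ∃ m : (A → ℝ) →L[ℝ] ℝ,
      (∀ d, fderiv ℝ P.smoothCost X₀ (localToGlobal q X₀ d) +
        m (fderiv ℝ G X₀ (localToGlobal q X₀ d)) = 0) ∧ ∀ y ∈ admissibleCone e, m y ≤ 0 := by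
    intro q
    obtain ⟨U, z, W, hU, hz, hW, hsub⟩ := hloc q
    have hstart : localToGlobalL q X₀ (localStart q X₀) = X₀ := localToGlobal_localStart q X₀
    have h := exists_multiplier_of_tendsto (e := e) (L := L) hf hG
      (((continuous_localToGlobalL q).tendsto X₀).comp hU) hz hW hsub hadm
      (by rw [hstart]; exact hfeas)
      (by
        rw [hstart]
        intro y
        obtain ⟨N, hN⟩ := hsurj y
        obtain ⟨d, hd⟩ := exists_localToGlobal_eq_compressedToGlobal q X₀ N
        exact ⟨d, (congrArg (fderiv ℝ G X₀) hd).trans hN⟩)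
    rw [hstart] at h
    exact h
  choose m hm hmle using hmult
  have hm_eq : ∀ q, m q = m 0 := by
    intro q
    ext y
    obtain ⟨N, rfl⟩ := hsurj y
    have h : ∀ q, m q (fderiv ℝ G X₀ (compressedToGlobal X₀ N)) =
        -fderiv ℝ P.smoothCost X₀ (compressedToGlobal X₀ N) := fun q => by
      obtain ⟨d, hd⟩ := exists_localToGlobal_eq_compressedToGlobal q X₀ N
      have := hm q d
      rw [hd] at this
      linarith
    exact (h q).trans (h 0).symm
  have hkkt : ∀ u, fderiv ℝ P.smoothCost X₀ u + m 0 (fderiv ℝ G X₀ u) = 0 := by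
    intro u
    have hblock : ∀ q, fderiv ℝ P.smoothCost X₀ (blockProj q u) +
        m 0 (fderiv ℝ G X₀ (blockProj q u)) = 0 := fun q => by
      have := hm q (blockToLocal q u)
      rwa [localToGlobal_blockToLocal, hm_eq] at this
    rw [← sum_blockProj u]
    simp only [map_sum]
    rw [← Finset.sum_add_distrib]
    exact Finset.sum_eq_zero fun q _ => hblock q
  exact regularSubdifferential_subset _ _ <| zero_mem_regularSubdifferential_of_multiplier (e := e)
    ((hf.differentiable one_ne_zero) X₀).hasFDerivAt
    ((hG.differentiable one_ne_zero) X₀).hasFDerivAt (hval X₀ hfin) hact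
    (fun X hX => ⟨hadm X hX, hval X hX⟩) hkkt (hmle 0)

/-! ### The non-smooth problem -/

theorem _root_.EReal.sum_ne_bot {ι : Type*} {s : Finset ι} {a : ι → EReal}
    (h : ∀ i ∈ s, a i ≠ ⊥) : ∑ i ∈ s, a i ≠ ⊥ := by
  classical
  induction s using Finset.induction_on with
  | empty => simp
  | insert i s hi ih =>
    rw [Finset.sum_insert hi]
    exact EReal.add_ne_bot_iff.2 ⟨h i (by simp), ih fun j hj => h j (by simp [hj])⟩

theorem _root_.EReal.ne_top_of_sum_ne_top {ι : Type*} {s : Finset ι} {a : ι → EReal}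
    (h : ∀ i ∈ s, a i ≠ ⊥) (hs : ∑ i ∈ s, a i ≠ ⊤) {i : ι} (hi : i ∈ s) : a i ≠ ⊤ := by
  classical
  intro ha
  refine hs ?_
  rw [← Finset.add_sum_erase _ _ hi, ha]
  exact EReal.top_add_of_ne_bot (EReal.sum_ne_bot fun j hj => h j (Finset.mem_of_mem_erase hj))

theorem _root_.EReal.coe_finset_sum {ι : Type*} (s : Finset ι) (a : ι → ℝ) :
    ((∑ i ∈ s, a i : ℝ) : EReal) = ∑ i ∈ s, (a i : EReal) := by
  classical
  induction s using Finset.induction_on with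
  | empty => simp
  | insert i s hi ih => rw [Finset.sum_insert hi, Finset.sum_insert hi, EReal.coe_add, ih]

/-- A regular subgradient of the local objective at node `q`, tested with variations of the block of
`q` only. -/
theorem eventually_le_of_mem_regularSubdifferential_localObjective {L : GlobalVar M Q → EReal}
    {q : Fin K} {U : GlobalVar M Q} {z W : LocalVar M Q q}
    (hW : W ∈ regularSubdifferential (localObjective L q U) z) {ε : ℝ} (hε : 0 < ε) :
    ∀ᶠ u in 𝓝 (0 : GlobalVar M Q),
      L (localToGlobal q U z) + ((inner ℝ W (blockToLocal q u) - ε * ‖u‖ : ℝ) : EReal) ≤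
        L (localToGlobal q U z + blockProj q u) := by
  have hlim : Tendsto (fun u : GlobalVar M Q => z + blockToLocal q u) (𝓝 0) (𝓝 z) := by
    have h : Continuous fun u : GlobalVar M Q => z + blockToLocal q u := by fun_prop
    simpa using h.tendsto 0
  set b := ‖(blockToLocal q : GlobalVar M Q →L[ℝ] LocalVar M Q q)‖ with hb
  have hb0 : 0 ≤ b := norm_nonneg _
  filter_upwards [hlim.eventually (hW.2.2 (ε / (b + 1)) (by positivity))] with u hu
  have h1 : localObjective L q U (z + blockToLocal q u) =
      L (localToGlobal q U z + blockProj q u) := by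
    rw [← localToGlobal_blockToLocal q U u]
    exact congrArg L (map_add (localToGlobalL q U) _ _)
  rw [h1, add_sub_cancel_left] at hu
  refine le_trans ?_ hu
  have h2 : ε / (b + 1) * ‖blockToLocal q u‖ ≤ ε * ‖u‖ := by
    calc ε / (b + 1) * ‖blockToLocal q u‖ ≤ ε / (b + 1) * (b * ‖u‖) := by
          gcongr
          exact ContinuousLinearMap.le_opNorm _ _
      _ ≤ ε / (b + 1) * ((b + 1) * ‖u‖) := by gcongr; linarith
      _ = ε * ‖u‖ := by field_simp
  exact add_le_add le_rfl (EReal.coe_le_coe_iff.2 (sub_le_sub_left h2 _))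

/-- A partial subgradient inequality for `f + ∑ k, h k` in the block of `q` passes to `h q`, since the
other summands `h k` do not depend on that block. -/
theorem eventually_le_of_separable {f : GlobalVar M Q → ℝ} {h : Fin K → GlobalVar M Q → EReal}
    {f' : GlobalVar M Q →L[ℝ] ℝ} {Y : GlobalVar M Q} (hf : HasFDerivAt f f' Y)
    (hbot : ∀ k X, h k X ≠ ⊥)
    (hblock : ∀ k X X', blockProj k X = blockProj k X' → h k X = h k X')
    (hfin : ∀ k, h k Y ≠ ⊤) {q : Fin K} {w : GlobalVar M Q → ℝ}
    (hw : ∀ ε : ℝ, 0 < ε → ∀ᶠ u in 𝓝 (0 : GlobalVar M Q),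
      (f Y + ∑ k, h k Y) + ((w u - ε * ‖u‖ : ℝ) : EReal) ≤
        f (Y + blockProj q u) + ∑ k, h k (Y + blockProj q u))
    {ε : ℝ} (hε : 0 < ε) :
    ∀ᶠ u in 𝓝 (0 : GlobalVar M Q),
      h q Y + ((w u - f' (blockProj q u) - ε * ‖u‖ : ℝ) : EReal) ≤ h q (Y + blockProj q u) := by
  classical
  have hfq : HasFDerivAt (fun u => f (Y + blockProj q u)) (f'.comp (blockProj q)) 0 := by
    refine HasFDerivAt.comp (0 : GlobalVar M Q) (g := f) (f := fun u => Y + blockProj q u) ?_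
      ((blockProj q).hasFDerivAt.const_add Y)
    simpa using hf
  filter_upwards [hw (ε / 2) (by positivity), hfq.isLittleO.bound (half_pos hε)] with u hu1 hu2
  by_cases htop : h q (Y + blockProj q u) = ⊤
  · simp [htop]
  have hrest : ∑ k ∈ Finset.univ.erase q, h k (Y + blockProj q u) =
      ∑ k ∈ Finset.univ.erase q, h k Y := by
    refine Finset.sum_congr rfl fun k hk => hblock k _ _ ?_
    rw [map_add, blockProj_blockProj_of_ne (Finset.ne_of_mem_erase hk), add_zero]
  rw [← Finset.add_sum_erase _ _ (Finset.mem_univ q),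
    ← Finset.add_sum_erase _ _ (Finset.mem_univ q), hrest] at hu1
  have hc : ∑ k ∈ Finset.univ.erase q, h k Y = ((∑ k ∈ Finset.univ.erase q, (h k Y).toReal : ℝ) :
      EReal) := by
    rw [EReal.coe_finset_sum]
    exact Finset.sum_congr rfl fun k _ => (EReal.coe_toReal (hfin k) (hbot k Y)).symm
  rw [hc, ← EReal.coe_toReal (hfin q) (hbot q Y), ← EReal.coe_toReal htop (hbot q _)] at hu1
  rw [← EReal.coe_toReal (hfin q) (hbot q Y), ← EReal.coe_toReal htop (hbot q _)]
  have h3 := (abs_le.1 (by simpa using hu2)).2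
  norm_cast at hu1 ⊢
  linarith

/-- For a smooth function plus a separable function, local almost-stationarity at all nodes implies
stationarity: the points with block `q` taken from node `q`, for all `q`, carry regular subgradients
assembled from those of the nodes, and these vanish in the limit. -/
theorem mem_stationaryPoints_of_separable {L : GlobalVar M Q → EReal} {f : GlobalVar M Q → ℝ}
    {h : Fin K → GlobalVar M Q → EReal} (hf : ContDiff ℝ 1 f) (hbot : ∀ k X, h k X ≠ ⊥)
    (hblock : ∀ k X X', blockProj k X = blockProj k X' → h k X = h k X')
    (hL : ∀ X, L X = f X + ∑ k, h k X) (hcont : ContinuousOn L {X | L X < ⊤})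
    {X₀ : GlobalVar M Q} (hfin : L X₀ ≠ ⊤) (hloc : ∀ q, IsLocallyAlmostStationary L q X₀) :
    X₀ ∈ stationaryPoints L := by
  classical
  have hdom : ∀ X, L X ≠ ⊤ ↔ ∀ k, h k X ≠ ⊤ := by
    intro X
    rw [hL]
    constructor
    · intro hX k
      refine EReal.ne_top_of_sum_ne_top (s := Finset.univ) (fun k _ => hbot k X) (fun hs => hX ?_)
        (Finset.mem_univ k)
      rw [hs]
      exact EReal.coe_add_top _
    · intro hX
      rw [show ∑ k, h k X = ((∑ k, (h k X).toReal : ℝ) : EReal) by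
        rw [EReal.coe_finset_sum]
        exact Finset.sum_congr rfl fun k _ => (EReal.coe_toReal (hX k) (hbot k X)).symm,
        ← EReal.coe_add]
      exact EReal.coe_ne_top _
  have hLbot : ∀ X, L X ≠ ⊥ := fun X => by
    rw [hL]
    exact EReal.add_ne_bot_iff.2 ⟨EReal.coe_ne_bot _, EReal.sum_ne_bot fun k _ => hbot k X⟩
  choose U z W hU hz hW hsub using hloc
  set Y : Fin K → ℕ → GlobalVar M Q := fun q l => localToGlobal q (U q l) (z q l) with hY
  have hYlim : ∀ q, Tendsto (Y q) atTop (𝓝 X₀) := fun q => by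
    have := (((continuous_localToGlobalL q).tendsto X₀).comp (hU q)).clm_apply (hz q)
    simpa [localToGlobal_localStart] using this
  have hYfin : ∀ q l k, h k (Y q l) ≠ ⊤ := fun q l => (hdom _).1 (hsub q l).1
  set V : ℕ → GlobalVar M Q := fun l => ∑ q, blockProj q (Y q l) with hV
  have hVlim : Tendsto V atTop (𝓝 X₀) := by
    have := tendsto_finsetSum Finset.univ fun q _ =>
      ((blockProj q).continuous.tendsto X₀).comp (hYlim q)
    rwa [sum_blockProj] at this
  have hVblock : ∀ q l, blockProj q (V l) = blockProj q (Y q l) := fun q l => by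
    rw [hV, map_sum, Finset.sum_eq_single q, blockProj_blockProj_self]
    · exact fun k _ hk => blockProj_blockProj_of_ne hk.symm _
    · simp
  have hVh : ∀ q l u, h q (V l + u) = h q (Y q l + blockProj q u) := fun q l u =>
    hblock q _ _ (by rw [map_add, map_add, hVblock, blockProj_blockProj_self])
  have hVh0 : ∀ q l, h q (V l) = h q (Y q l) := fun q l => hblock q _ _ (hVblock q l)
  have hVfin : ∀ l, L (V l) ≠ ⊤ := fun l => (hdom _).2 fun k => by
    rw [hVh0]
    exact hYfin k l k
  have hgrad : Continuous (gradient f) :=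
    (InnerProductSpace.toDual ℝ (GlobalVar M Q)).symm.continuous.comp
      (hf.continuous_fderiv one_ne_zero)
  have hdiff := hf.differentiable one_ne_zero
  refine ⟨hfin, hLbot _, V, fun l => gradient f (V l) +
    ∑ q, (ContinuousLinearMap.adjoint (blockToLocal q) (W q l) -
      blockProj q (gradient f (Y q l))), hVlim, ?_, fun l => ⟨hVfin l, hLbot _, ?_⟩, ?_⟩
  · exact (hcont X₀ (lt_top_iff_ne_top.2 hfin)).tendsto.comp
      (tendsto_nhdsWithin_iff.2 ⟨hVlim, Eventually.of_forall fun l => lt_top_iff_ne_top.2 (hVfin l)⟩)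
  · intro ε hε
    -- the error `ε` is shared by `f` and the `K` summands
    set δ := ε / (K + 1) with hδ
    have hδ0 : 0 < δ := by positivity
    have hblocks : ∀ q, ∀ᶠ u in 𝓝 (0 : GlobalVar M Q),
        h q (Y q l) + ((inner ℝ (W q l) (blockToLocal q u) -
          fderiv ℝ f (Y q l) (blockProj q u) - δ * ‖u‖ : ℝ) : EReal) ≤
        h q (Y q l + blockProj q u) := fun q =>
      eventually_le_of_separable (f := f) (hdiff _).hasFDerivAt hbot hblock (hYfin q l)
        (fun ε' hε' => by
          simpa only [hL] using
            eventually_le_of_mem_regularSubdifferential_localObjective (hsub q l) hε') hδ0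
    have hf0 := (hdiff (V l)).hasFDerivAt.isLittleO.bound hδ0
    have hshift : Tendsto (fun X => X - V l) (𝓝 (V l)) (𝓝 0) := by
      have : Continuous fun X => X - V l := by fun_prop
      simpa using this.tendsto (V l)
    filter_upwards [hshift.eventually (eventually_all.2 hblocks), hf0] with X hX hfX
    by_cases htop : L X = ⊤
    · simp [htop]
    have hXfin := (hdom X).1 htop
    have hreal : ∀ Z, (∀ k, h k Z ≠ ⊤) → L Z = ((f Z + ∑ k, (h k Z).toReal : ℝ) : EReal) := by
      intro Z hZ
      rw [hL, EReal.coe_add, EReal.coe_finset_sum]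
      congr 1
      exact Finset.sum_congr rfl fun k _ => (EReal.coe_toReal (hZ k) (hbot k Z)).symm
    set u := X - V l with hu
    have hXu : V l + u = X := by rw [hu]; abel
    have hq : ∀ q, (h q (V l)).toReal + (inner ℝ (W q l) (blockToLocal q u) -
        fderiv ℝ f (Y q l) (blockProj q u) - δ * ‖u‖) ≤ (h q X).toReal := by
      intro q
      have h1 := hX q
      rw [← hVh, hXu, ← hVh0, ← EReal.coe_toReal (hXfin q) (hbot q X),
        ← EReal.coe_toReal (((hdom _).1 (hVfin l)) q) (hbot q _)] at h1
      exact_mod_cast h1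
    have hsum := Finset.sum_le_sum fun q (_ : q ∈ Finset.univ) => hq q
    rw [Finset.sum_add_distrib, Finset.sum_sub_distrib, Finset.sum_const, Finset.card_univ,
      Fintype.card_fin, nsmul_eq_mul] at hsum
    have hf1 := (abs_le.1 (by simpa using hfX)).1
    rw [hreal X hXfin, hreal (V l) ((hdom _).1 (hVfin l))]
    have hinner : inner ℝ (gradient f (V l) +
        ∑ q, (ContinuousLinearMap.adjoint (blockToLocal q) (W q l) -
          blockProj q (gradient f (Y q l)))) u =
        fderiv ℝ f (V l) u + ∑ q, (inner ℝ (W q l) (blockToLocal q u) -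
          fderiv ℝ f (Y q l) (blockProj q u)) := by
      rw [inner_add_left, inner_gradient_left, sum_inner]
      congr 1
      refine Finset.sum_congr rfl fun q _ => ?_
      rw [inner_sub_left, ContinuousLinearMap.adjoint_inner_left, inner_blockProj,
        inner_gradient_left]
    have hεδ : ε * ‖u‖ = K * (δ * ‖u‖) + δ * ‖u‖ := by
      rw [hδ]
      field_simp
    rw [hinner]
    rw [map_sub] at hf1
    have hu' : fderiv ℝ f (V l) u = fderiv ℝ f (V l) X - fderiv ℝ f (V l) (V l) := by
      rw [hu, map_sub]
    norm_cast
    linarith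
  · have h1 : Tendsto (fun l => gradient f (V l)) atTop (𝓝 (gradient f X₀)) :=
      (hgrad.tendsto X₀).comp hVlim
    have h2 := h1.add (tendsto_finsetSum Finset.univ fun q _ =>
      (((ContinuousLinearMap.adjoint (blockToLocal (M := M) (Q := Q) q)).continuous.tendsto 0).comp
        (hW q)).sub (((blockProj q).continuous.tendsto _).comp
          ((hgrad.tendsto X₀).comp (hYlim q))))
    have h3 : gradient f X₀ + ∑ q, (ContinuousLinearMap.adjoint (blockToLocal q) 0 -
        blockProj q (gradient f X₀)) = 0 := by
      simp [sum_blockProj]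
    rwa [h3] at h2

/-- The smooth part of the cost. -/
noncomputable def NonsmoothProblem.smoothCost (P : NonsmoothProblem M Q S) (X : GlobalVar M Q) :
    ℝ :=
  P.φ (filterOutput X.mat P.y) (X.mat.transpose * P.B)

open Classical in
/-- The part of the objective that depends on the block of node `k` only: `γ_k` and the indicator
function of the constraints of `k`. -/
noncomputable def NonsmoothProblem.nodeCost (P : NonsmoothProblem M Q S) (k : Fin K)
    (X : GlobalVar M Q) : EReal :=
  P.γ k ((block X k).transpose * P.A k) +
    if ∀ j, P.node j = k → (P.isEq j → (Problem.nonsmooth P).constraint j X = 0) ∧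
      (¬ P.isEq j → (Problem.nonsmooth P).constraint j X ≤ 0) then 0 else ⊤

theorem NonsmoothProblem.nodeCost_ne_bot (P : NonsmoothProblem M Q S) (k : Fin K)
    (X : GlobalVar M Q) : P.nodeCost k X ≠ ⊥ := by
  refine EReal.add_ne_bot_iff.2 ⟨P.γ_ne_bot _ _, ?_⟩
  split_ifs <;> simp

theorem NonsmoothProblem.nodeCost_congr (P : NonsmoothProblem M Q S) {k : Fin K}
    {X X' : GlobalVar M Q} (h : blockProj k X = blockProj k X') :
    P.nodeCost k X = P.nodeCost k X' := by
  have hb := block_eq_of_blockProj_eq h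
  have hc : ∀ j, P.node j = k →
      (Problem.nonsmooth P).constraint j X = (Problem.nonsmooth P).constraint j X' := by
    rintro j rfl
    simp only [Problem.constraint, hb]
  unfold NonsmoothProblem.nodeCost
  rw [hb]
  congr 2
  refine propext (forall_congr' fun j => forall_congr' fun hj => ?_)
  rw [hc j hj]

theorem NonsmoothProblem.objective_eq (P : NonsmoothProblem M Q S) (X : GlobalVar M Q) :
    (Problem.nonsmooth P).objective X = P.smoothCost X + ∑ k, P.nodeCost k X := by
  classical
  simp only [NonsmoothProblem.nodeCost, Finset.sum_add_distrib, ← add_assoc]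
  rw [Problem.objective]
  congr 1
  by_cases hX : X ∈ (Problem.nonsmooth P).feasibleSet
  · rw [if_pos hX]
    exact (Finset.sum_eq_zero fun k _ => if_pos fun j _ => hX j).symm
  · rw [if_neg hX]
    by_contra hne
    refine hX fun j => ?_
    have h := EReal.ne_top_of_sum_ne_top (fun k _ => by split_ifs <;> simp) (Ne.symm hne)
      (Finset.mem_univ (P.node j))
    by_contra hj
    exact h (if_neg fun hall => hj (hall j rfl))

theorem NonsmoothProblem.mem_stationaryPoints (P : NonsmoothProblem M Q S)
    (hcont : ContinuousOn (Problem.nonsmooth P).objective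
      {Z | (Problem.nonsmooth P).objective Z < ⊤})
    {X₀ : GlobalVar M Q} (hfin : (Problem.nonsmooth P).objective X₀ ≠ ⊤)
    (hloc : ∀ q, IsLocallyAlmostStationary (Problem.nonsmooth P).objective q X₀) :
    X₀ ∈ stationaryPoints (Problem.nonsmooth P).objective :=
  mem_stationaryPoints_of_separable P.smooth_φ P.nodeCost_ne_bot
    (fun _ _ _ h => P.nodeCost_congr h) P.objective_eq hcont hfin hloc

theorem Problem.objective_ne_bot (P : Problem M Q S) (X : GlobalVar M Q) : P.objective X ≠ ⊥ := by
  refine EReal.add_ne_bot_iff.2 ⟨?_, by split_ifs <;> simp⟩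
  cases P with
  | smooth P => exact EReal.coe_ne_bot _
  | nonsmooth P =>
    exact EReal.add_ne_bot_iff.2
      ⟨EReal.coe_ne_bot _, EReal.sum_ne_bot fun k _ => P.γ_ne_bot _ _⟩

end StationarityFromLocal

/-! ### Descent sequences and their cluster points -/

section Sequences

/-- In a compact set, a sequence converges to any set that contains all its cluster points. -/
theorem tendsto_infDist_of_mapClusterPt {H : Type*} [MetricSpace H] {x : ℕ → H} {C Ω : Set H}
    (hC : IsCompact C) (hx : ∀ᶠ i in atTop, x i ∈ C) (hΩ : ∀ z, MapClusterPt z atTop x → z ∈ Ω) :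
    Tendsto (fun i => Metric.infDist (x i) Ω) atTop (𝓝 0) := by
  rw [Metric.tendsto_atTop']
  by_contra! hcon
  obtain ⟨ε, hε, h⟩ := hcon
  have hfar : IsCompact (C ∩ {y | ε ≤ Metric.infDist y Ω}) :=
    hC.inter_right (isClosed_le continuous_const (Metric.continuous_infDist_pt Ω))
  have hfreq : ∃ᶠ i in atTop, x i ∈ C ∩ {y | ε ≤ Metric.infDist y Ω} := by
    refine Frequently.and_eventually ?_ hx |>.mono fun i hi => ⟨hi.2, hi.1⟩
    rw [frequently_atTop]
    intro n
    obtain ⟨i, hi, hi'⟩ := h n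
    refine ⟨i, hi.le, ?_⟩
    rwa [Real.dist_0_eq_abs, abs_of_nonneg Metric.infDist_nonneg] at hi'
  obtain ⟨z, hz, hcl⟩ := hfar.exists_mapClusterPt_of_frequently hfreq
  have h0 := Metric.infDist_zero_of_mem (hΩ z hcl)
  have := hz.2
  rw [Set.mem_ofPred_eq, h0] at this
  linarith

/-- A sequence whose steps vanish and which converges to a finite set converges to a point of the
set, since eventually it cannot jump between neighborhoods of different points. -/
theorem exists_tendsto_of_finite {H : Type*} [MetricSpace H] {x : ℕ → H} {Ω : Set H}
    (hfin : Ω.Finite) (hΩ : Tendsto (fun i => Metric.infDist (x i) Ω) atTop (𝓝 0))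
    (hstep : Tendsto (fun i => dist (x (i + 1)) (x i)) atTop (𝓝 0)) {z : H} (hz : z ∈ Ω)
    (hcl : MapClusterPt z atTop x) : Tendsto x atTop (𝓝 z) := by
  obtain ⟨δ, hδ, hball⟩ := Metric.mem_nhds_iff.1
    ((hfin.subset (Set.sdiff_subset (t := {z}))).isClosed.isOpen_compl.mem_nhds
      (show z ∈ (Ω \ {z})ᶜ from fun h => h.2 rfl))
  have hsep : ∀ y ∈ Ω, dist y z < δ → y = z := fun y hy hyz => by
    by_contra hne
    exact hball hyz ⟨hy, hne⟩
  rw [Metric.tendsto_atTop]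
  intro ε hε
  set η := min ε (δ / 3) with hη
  have hη0 : 0 < η := by positivity
  have hηδ : 3 * η ≤ δ := by linarith [min_le_right ε (δ / 3)]
  obtain ⟨n, hn⟩ := eventually_atTop.1
    ((hΩ.eventually_lt_const hη0).and (hstep.eventually_lt_const hη0))
  obtain ⟨i, hi, hiz⟩ := frequently_atTop.1
    (hcl.frequently (Metric.ball_mem_nhds z hη0)) n
  refine ⟨i, fun j hj => ?_⟩
  have hjz : dist (x j) z < η := by
    induction j, hj using Nat.le_induction with
    | base => exact hiz
    | succ j hj ih =>
      obtain ⟨y, hy, hyx⟩ := (Metric.infDist_lt_iff ⟨z, hz⟩).1 (hn (j + 1) (by omega)).1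
      have h1 := (hn j (by omega)).2
      have h2 : dist y z < δ := by
        have := dist_triangle4 y (x (j + 1)) (x j) z
        rw [dist_comm y (x (j + 1))] at this
        linarith
      rwa [hsep y hy h2] at hyx
  exact hjz.trans_le (min_le_left _ _)

theorem eventually_const_lt_of_lt_liminf {R : ℕ → ℝ}
    (h : 0 < liminf (fun i => (R i : EReal)) atTop) :
    ∃ r : ℝ, 0 < r ∧ ∀ᶠ i in atTop, r < R i := by
  obtain ⟨r, hr0, hr⟩ := EReal.lt_iff_exists_real_btwn.1 h
  refine ⟨r, by exact_mod_cast hr0, (eventually_lt_of_lt_liminf hr).mono fun i hi => ?_⟩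
  exact_mod_cast hi

theorem eventually_lt_const_of_limsup_lt {c : ℕ → ℝ}
    (h : limsup (fun i => (c i : EReal)) atTop < ⊤) :
    ∃ b : ℝ, ∀ᶠ i in atTop, c i < b := by
  obtain ⟨b, hb, -⟩ := EReal.lt_iff_exists_real_btwn.1 h
  refine ⟨b, (eventually_lt_of_limsup_lt hb).mono fun i hi => ?_⟩
  exact_mod_cast hi

theorem antitone_of_sufficient_decrease {E : Type*} [NormedAddCommGroup E] {f : E → EReal}
    {x : ℕ → E} {R : ℝ} (hR : 0 ≤ R)
    (hdec : ∀ j, f (x (j + 1)) + ((R * ‖x j - x (j + 1)‖ ^ 2 : ℝ) : EReal) ≤ f (x j)) :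
    Antitone fun j => f (x j) := antitone_nat_of_succ_le fun j => by
  refine le_trans ?_ (hdec j)
  have h0 : (0 : EReal) ≤ ((R * ‖x j - x (j + 1)‖ ^ 2 : ℝ) : EReal) := by
    exact_mod_cast mul_nonneg hR (sq_nonneg _)
  simpa using add_le_add (le_refl (f (x (j + 1)))) h0

/-- The steps of a descent method with sufficient decrease are controlled by the total decrease. -/
theorem norm_sub_le_of_sufficient_decrease {E : Type*} [NormedAddCommGroup E] {f : E → EReal}
    {x : ℕ → E} {R r a b : ℝ} {n : ℕ} (hr : 0 < r) (hrR : r ≤ R)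
    (hdec : ∀ j, f (x (j + 1)) + ((R * ‖x j - x (j + 1)‖ ^ 2 : ℝ) : EReal) ≤ f (x j))
    (ha : f (x 0) = a) (hb : f (x n) = b) {j : ℕ} (hj : j < n) :
    ‖x j - x (j + 1)‖ ≤ √((a - b) / r) := by
  have hanti := antitone_of_sufficient_decrease (hr.le.trans hrR) hdec
  have h1 : (b : EReal) + ((R * ‖x j - x (j + 1)‖ ^ 2 : ℝ) : EReal) ≤ a := by
    rw [← ha, ← hb]
    exact (add_le_add (hanti hj) le_rfl).trans ((hdec j).trans (hanti (Nat.zero_le j)))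
  have h2 : b + R * ‖x j - x (j + 1)‖ ^ 2 ≤ a := by exact_mod_cast h1
  refine Real.le_sqrt_of_sq_le ?_
  rw [le_div_iff₀ hr]
  nlinarith [mul_le_mul_of_nonneg_right hrR (sq_nonneg ‖x j - x (j + 1)‖)]

end Sequences

/-! ### Asymptotics of the algorithm -/

section Algorithm

variable {K : ℕ} {M : Fin K → ℕ} {Q : ℕ}

theorem exists_updatingNode_add (K : ℕ) [NeZero K] (q : Fin K) (i : ℕ) :
    ∃ r < K, updatingNode K (i + r) = q := by
  have hK : 0 < K := Nat.pos_of_ne_zero (NeZero.ne K)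
  have hi : i % K < K := Nat.mod_lt _ hK
  refine ⟨(q + (K - i % K)) % K, Nat.mod_lt _ hK, Fin.ext ?_⟩
  change (i + (q + (K - i % K)) % K) % K = q
  rw [Nat.add_mod_mod, Nat.add_mod, Nat.add_mod q.1, Nat.add_mod_mod, ← Nat.add_mod_mod,
    ← Nat.add_mod q.1]
  have : (i % K + (q + (K - i % K))) = q + K := by omega
  simp only [Nat.add_mod_mod]
  rw [this, Nat.add_mod_right, Nat.mod_eq_of_lt q.2]

/-- The asymptotics of the algorithm: the filters remain in a sublevel set, their steps vanish, and
the local objectives have almost vanishing regular subgradients arbitrarily close to the starting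
points of the local solvers. -/
theorem IsInexactDASFSequence.asymptotics [NeZero K] {L : GlobalVar M Q → EReal}
    {X : ℕ → GlobalVar M Q} (hX : IsInexactDASFSequence L X) (hbot : ∀ Z, L Z ≠ ⊥)
    (hcont : ContinuousOn L {Z | L Z < ⊤}) (hcompact : ∀ α : ℝ, IsCompact {Z | L Z ≤ (α : EReal)}) :
    (∃ α : ℝ, ∀ᶠ i in atTop, L (X i) ≤ α) ∧
    Tendsto (fun i => dist (X (i + 1)) (X i)) atTop (𝓝 0) ∧
    ∀ ε : ℝ, 0 < ε → ∀ᶠ i in atTop, ∀ q, updatingNode K i = q → ∃ z W : LocalVar M Q q,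
      W ∈ regularSubdifferential (localObjective L q (X i)) z ∧ ‖W‖ < ε ∧
      dist z (localStart q (X i)) < ε := by
  obtain ⟨n, Xt, hn, ⟨N, hN⟩, ⟨R, c, hinit, hdec, hcrit, hR, hc⟩, hnext⟩ := hX
  obtain ⟨r, hr, hrR⟩ := eventually_const_lt_of_lt_liminf hR
  obtain ⟨b, hb⟩ := eventually_lt_const_of_limsup_lt hc
  have hstart : ∀ i, localObjective L (updatingNode K i) (X i) (Xt i 0) = L (X i) := fun i => by
    rw [hinit, localObjective, localToGlobal_localStart]
  have hend : ∀ i, localObjective L (updatingNode K i) (X i) (Xt i (n i)) = L (X (i + 1)) :=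
    fun i => by rw [hnext, localObjective]
  -- the initial filter need not be feasible, but all the others are
  have hfin : ∀ i, L (X (i + 1)) ≠ ⊤ := fun i => by
    obtain ⟨W, hW, -⟩ := (hcrit i).2 (n i - 1)
    rw [Nat.sub_add_cancel (hn i)] at hW
    rw [← hend]
    exact hW.1
  have hmono : ∀ i, L (X (i + 1)) ≤ L (X i) := fun i =>
    (hend i).symm.trans_le <| (antitone_of_sufficient_decrease (hdec i).1.le (hdec i).2
      (Nat.zero_le (n i))).trans_eq (hstart i)
  set ℓ : ℕ → ℝ := fun i => (L (X (i + 1))).toReal with hℓ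
  have hLℓ : ∀ i, L (X (i + 1)) = ℓ i := fun i => (EReal.coe_toReal (hfin i) (hbot _)).symm
  have hℓanti : Antitone ℓ := antitone_nat_of_succ_le fun i => by
    have := hmono (i + 1)
    rw [hLℓ, hLℓ] at this
    exact_mod_cast this
  set C := {Z | L Z ≤ (ℓ 0 : EReal)} with hC
  have hXC : ∀ i, X (i + 1) ∈ C := fun i => by
    rw [hC, Set.mem_ofPred_eq, hLℓ]
    exact_mod_cast hℓanti (Nat.zero_le i)
  obtain ⟨Z₀, hZ₀, hmin⟩ := (hcompact (ℓ 0)).exists_isMinOn ⟨_, hXC 0⟩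
    (hcont.mono fun Z hZ => lt_of_le_of_lt hZ (EReal.coe_lt_top _))
  have hbdd : BddBelow (Set.range ℓ) := by
    refine ⟨(L Z₀).toReal, ?_⟩
    rintro _ ⟨i, rfl⟩
    exact EReal.toReal_le_toReal (hmin (hXC i)) (hbot _) (hfin i)
  have hℓlim := tendsto_atTop_ciInf hℓanti hbdd
  set δ : ℕ → ℝ := fun i => √((ℓ i - ℓ (i + 1)) / r) with hδ
  have hδlim : Tendsto δ atTop (𝓝 0) := by
    have h := ((hℓlim.sub (hℓlim.comp (tendsto_add_atTop_nat 1))).div_const r).sqrt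
    simpa using h
  have hstep : ∀ᶠ i in atTop, ∀ j < n (i + 1),
      ‖Xt (i + 1) j - Xt (i + 1) (j + 1)‖ ≤ δ i := by
    filter_upwards [(tendsto_add_atTop_nat 1).eventually hrR] with i hi j hj
    exact norm_sub_le_of_sufficient_decrease hr hi.le (hdec (i + 1)).2
      ((hstart _).trans (hLℓ i)) ((hend _).trans (hLℓ (i + 1))) hj
  have htotal : ∀ᶠ i in atTop,
      dist (Xt (i + 1) (n (i + 1))) (Xt (i + 1) 0) ≤ N * δ i := by
    filter_upwards [hstep] with i hi
    rw [dist_comm]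
    refine (dist_le_range_sum_of_dist_le (f := Xt (i + 1)) (d := fun _ => δ i) _
      fun {j} hj => by rw [dist_eq_norm]; exact hi j hj).trans ?_
    rw [Finset.sum_const, Finset.card_range, nsmul_eq_mul]
    exact mul_le_mul_of_nonneg_right (by exact_mod_cast hN (i + 1)) (Real.sqrt_nonneg _)
  have hNδ : Tendsto (fun i => N * δ i) atTop (𝓝 0) := by simpa using hδlim.const_mul (N : ℝ)
  refine ⟨⟨ℓ 0, ?_⟩, ?_, fun ε hε => ?_⟩
  · rw [← map_add_atTop_eq_nat 1, eventually_map]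
    exact Eventually.of_forall hXC
  · have hop : ∀ q : Fin K, ∃ B, ∀ Z ∈ C, ‖localToGlobalL q Z‖ ≤ B := fun q =>
      (hcompact (ℓ 0)).exists_bound_of_continuousOn (continuous_localToGlobalL q).continuousOn
    choose B hB using hop
    obtain ⟨B₀, hB₀⟩ := Finite.exists_le B
    refine (tendsto_add_atTop_iff_nat 1).1 ?_
    refine squeeze_zero' (Eventually.of_forall fun _ => dist_nonneg) ?_
      (by simpa using hNδ.const_mul B₀)
    filter_upwards [htotal] with i hi
    have hB₀i : ‖localToGlobalL (updatingNode K (i + 1)) (X (i + 1))‖ ≤ B₀ :=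
      (hB _ _ (hXC i)).trans (hB₀ _)
    have h1 : X (i + 1) = localToGlobal (updatingNode K (i + 1)) (X (i + 1)) (Xt (i + 1) 0) := by
      rw [hinit, localToGlobal_localStart]
    calc dist (X (i + 1 + 1)) (X (i + 1))
        = ‖localToGlobalL (updatingNode K (i + 1)) (X (i + 1))
            (Xt (i + 1) (n (i + 1)) - Xt (i + 1) 0)‖ := by
          rw [map_sub, localToGlobalL_apply, localToGlobalL_apply, ← h1, ← hnext, dist_eq_norm]
      _ ≤ B₀ * (N * δ i) := by
          refine (ContinuousLinearMap.le_opNorm _ _).trans ?_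
          rw [← dist_eq_norm]
          exact mul_le_mul hB₀i hi dist_nonneg ((norm_nonneg _).trans hB₀i)
  · have hbδ : Tendsto (fun i => b * δ i) atTop (𝓝 0) := by simpa using hδlim.const_mul b
    rw [← map_add_atTop_eq_nat 1, eventually_map]
    filter_upwards [hstep, htotal, (tendsto_add_atTop_nat 1).eventually hb,
      hNδ.eventually_lt_const (half_pos hε), hbδ.eventually_lt_const (half_pos hε)]
      with i hi1 hi2 hi3 hi4 hi5
    rintro _ rfl
    obtain ⟨W, hW, hWle⟩ := (hcrit (i + 1)).2 (n (i + 1) - 1)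
    have hlt : n (i + 1) - 1 < n (i + 1) := Nat.sub_lt (hn _) one_pos
    have hWδ : ‖W‖ < ε / 2 :=
      calc ‖W‖ ≤ b * δ i := hWle.trans
            (mul_le_mul hi3.le (hi1 _ hlt) (norm_nonneg _) ((hcrit (i + 1)).1.le.trans hi3.le))
        _ < ε / 2 := hi5
    rw [Nat.sub_add_cancel (hn _)] at hW
    obtain ⟨-, -, xs, vs, hxs, -, hvs, hvlim⟩ := hW
    obtain ⟨j, hj1, hj2⟩ := ((hxs.eventually (Metric.ball_mem_nhds _ (half_pos hε))).and
      (hvlim.eventually (Metric.ball_mem_nhds _ (half_pos hε)))).exists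
    have hj1' : dist (xs j) (Xt (i + 1) (n (i + 1))) < ε / 2 := hj1
    have hj2' : dist (vs j) W < ε / 2 := hj2
    refine ⟨xs j, vs j, hvs j, ?_, ?_⟩
    · have h1 := norm_le_norm_add_norm_sub W (vs j)
      rw [norm_sub_rev, ← dist_eq_norm] at h1
      linarith
    · have := dist_triangle (xs j) (Xt (i + 1) (n (i + 1))) (Xt (i + 1) 0)
      rw [← hinit]
      linarith

/-- Every node sees every cluster point as almost stationary: since the steps vanish, the sequence is
still close to the cluster point when it is the turn of the node. -/
theorem isLocallyAlmostStationary_of_mapClusterPt [NeZero K] {L : GlobalVar M Q → EReal}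
    {X : ℕ → GlobalVar M Q} (hstep : Tendsto (fun i => dist (X (i + 1)) (X i)) atTop (𝓝 0))
    (hsub : ∀ ε : ℝ, 0 < ε → ∀ᶠ i in atTop, ∀ q, updatingNode K i = q → ∃ z W : LocalVar M Q q,
      W ∈ regularSubdifferential (localObjective L q (X i)) z ∧ ‖W‖ < ε ∧
      dist z (localStart q (X i)) < ε)
    {X₀ : GlobalVar M Q} (hcl : MapClusterPt X₀ atTop X) (q : Fin K) :
    IsLocallyAlmostStationary L q X₀ := by
  have hclose : ∀ ε : ℝ, 0 < ε → ∃ (U : GlobalVar M Q) (z W : LocalVar M Q q),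
      W ∈ regularSubdifferential (localObjective L q U) z ∧ ‖W‖ < ε ∧
      dist z (localStart q U) < ε ∧ dist U X₀ < ε := by
    intro ε hε
    set η := ε / (K + 1) with hη
    have hη0 : 0 < η := by positivity
    obtain ⟨n, hn⟩ := eventually_atTop.1 ((hsub ε hε).and (hstep.eventually_lt_const hη0))
    obtain ⟨i, hi, hiX⟩ := frequently_atTop.1
      (hcl.frequently (Metric.ball_mem_nhds X₀ hη0)) n
    obtain ⟨r, hrK, hr⟩ := exists_updatingNode_add K q i
    obtain ⟨z, W, hW, hWε, hzε⟩ := (hn (i + r) (by omega)).1 q hr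
    refine ⟨X (i + r), z, W, hW, hWε, hzε, ?_⟩
    have h1 : dist (X i) (X (i + r)) ≤ r * η := by
      refine (dist_le_range_sum_of_dist_le (f := fun s => X (i + s)) (d := fun _ => η) r
        fun {s} _ => ?_).trans ?_
      · rw [dist_comm]
        exact (hn (i + s) (by omega)).2.le
      · simp
    have h2 : (r : ℝ) * η ≤ K * η :=
      mul_le_mul_of_nonneg_right (by exact_mod_cast hrK.le) hη0.le
    have h3 : K * η + η = ε := by rw [hη]; field_simp
    have h4 := dist_triangle (X (i + r)) (X i) X₀
    rw [dist_comm (X (i + r)) (X i)] at h4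
    have hiX' : dist (X i) X₀ < η := hiX
    linarith
  choose U z W hW hWε hzε hUε using fun l : ℕ => hclose (1 / ((l : ℝ) + 1)) (by positivity)
  have hlim := tendsto_one_div_add_atTop_nhds_zero_nat (𝕜 := ℝ)
  have hU : Tendsto U atTop (𝓝 X₀) :=
    tendsto_iff_dist_tendsto_zero.2
      (squeeze_zero (fun _ => dist_nonneg) (fun l => (hUε l).le) hlim)
  refine ⟨U, z, W, hU, ?_, squeeze_zero_norm (fun l => (hWε l).le) hlim, hW⟩
  refine (tendsto_iff_of_dist ?_).2 (((continuous_localStart q).tendsto X₀).comp hU)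
  exact squeeze_zero (fun _ => dist_nonneg) (fun l => (hzε l).le) hlim

end Algorithm

end DASF

theorem theorem1 {K : ℕ} [NeZero K] (M : Fin K → ℕ) (Q : ℕ) {S : Type*}
    (P : DASF.Problem M Q S) (X : ℕ → DASF.GlobalVar M Q)
    (hX : DASF.IsInexactDASFSequence P.objective X)
    (hcont : ContinuousOn P.objective {Z | P.objective Z < ⊤})
    (hcompact : ∀ α : ℝ, IsCompact {Z | P.objective Z ≤ (α : EReal)})
    (hlicq : ∀ Z, MapClusterPt Z Filter.atTop X → P.CompressedLICQ Z) :
    ((DASF.stationaryPoints P.objective).Nonempty ∧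
      Filter.Tendsto (fun i => Metric.infDist (X i) (DASF.stationaryPoints P.objective))
        Filter.atTop (nhds 0)) ∧
    ((DASF.stationaryPoints P.objective).Finite →
      ∃ Z ∈ DASF.stationaryPoints P.objective, Filter.Tendsto X Filter.atTop (nhds Z)) := by
  obtain ⟨⟨α, hα⟩, hstep, hsub⟩ := hX.asymptotics P.objective_ne_bot hcont hcompact
  have hstat : ∀ Z, MapClusterPt Z atTop X → Z ∈ DASF.stationaryPoints P.objective := by
    intro Z hZ
    have hfin : P.objective Z ≠ ⊤ :=
      ne_top_of_le_ne_top (EReal.coe_ne_top α) ((hcompact α).isClosed.mem_of_mapClusterPt hZ hα)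
    have hloc := DASF.isLocallyAlmostStationary_of_mapClusterPt hstep hsub hZ
    cases P with
    | smooth P => exact P.mem_stationaryPoints hfin (hlicq Z hZ) hloc
    | nonsmooth P => exact P.mem_stationaryPoints hcont hfin hloc
  obtain ⟨Z, -, hZ⟩ := (hcompact α).exists_mapClusterPt_of_frequently hα.frequently
  have hdist := DASF.tendsto_infDist_of_mapClusterPt (hcompact α) hα hstat
  exact ⟨⟨⟨Z, hstat Z hZ⟩, hdist⟩, fun hfinite =>
    ⟨Z, hstat Z hZ, DASF.exists_tendsto_of_finite hfinite hdist hstep (hstat Z hZ) hZ⟩⟩
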